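/- **Setting.** Let $n=Cb$ and let $Q\in\mathbb R^{n\times d}$ be generated as follows. Cluster centres $c_1,\dots,c_C\in\mathbb R^d$ are independent centred Gaussian vectors whose coordinates are independent with standard deviation $1/\sqrt d$. For $1\le i\le C$, $1\le j\le b$, $r_{ij}\in\mathbb R^d$ are centred Gaussian vectors, independent of each other and of the centres, whose coordinates are independent with standard deviation $\Delta/\sqrt d$. The rows of $Q$ are $z_{ij}=c_i+r_{ij}$. Let $M_\beta=\exp(\beta QQ^{\top})$, where $\exp$ is applied entrywise. Fix constants $\gamma,\kappa,K,L>0$ and assume $$C\ge\gamma n,\qquad d\ge\kappa\log^{3/2}n,\qquad 0\le\Delta\le \frac{K}{\log^{1/4}n},\qquad (1-\Delta^2)\log n\le\beta\le L\log n .$$ For $k$ a power of $2$ with $k\ge2$ and $k\mid N$, a *block butterfly factor matrix* $\mathbf B_k$ of size $Nb$, stride $k$ and block size $b$ is a block diagonal matrix of $N/k$ pieces $\begin{bmatrix}D_1&D_2\\D_3&D_4\end{bmatrix}$, where each $D_i$ is a block diagonal matrix of $k/2$ arbitrary $b\times b$ blocks. A *flat block butterfly* matrix of block size $b$ and maximum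 stride $k=2^m$, $m\ge1$, is a matrix $I+\lambda(\mathbf B_2+\mathbf B_4+\dots+\mathbf B_{k})$ with $\lambda\in\mathbb R$. A *flat block butterfly + low-rank* matrix is $F+UV^{\top}$ with $F$ flat block butterfly and $U,V\in\mathbb R^{n\times r}$. With $N=C$, its number of parameters is $1+2mCb^2+2nr$. **Theorem.** Each of the following holds with probability $1-o(1)$ as $n\to\infty$. The $o(1)$ terms and the constants $c'$ depend only on $\gamma,\kappa,K,L$ and on the quantities fixed in the respective item ($\epsilon$; $c,\delta$; $c$; the sequence $s$). 1. *(Flat block butterfly + low-rank)* Let $\epsilon\in(0,1)$. If $C$ is even, there is a flat block butterfly + low-rank matrix $R$ of block size $b$ with at most $n^{1+o(1)}$ parameters such that $\|M_\beta-R\|_F\le\epsilon n$. 2. *(Low-rank)* (a) For all $c,\delta>0$ there is $c'>0$ such that, if $\Delta\ge n^{-1/4+\delta}$, every $R\in\mathbb R^{n\times n}$ with $n-\operatorname{rank}(R)\ge cn$ satisfies $\|M_\beta-R\|_F\ge c'n$. (b) Without a lower bound on $\Delta$: for every $c>0$ there is $c'>0$ such that every $R\in\mathbb R^{n\times n}$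 with $C-\operatorname{rank}(R)\ge cn$ satisfies $\|M_\beta-R\|_F\ge c'n$. (For $b=1$ the condition reads $n-\operatorname{rank}(R)\ge cn$.) 3. *(Sparse)* For every sequence $s(n)=o(n^2)$ there is $c'>0$ such that every $R\in\mathbb R^{n\times n}$ with at most $s(n)$ nonzero entries satisfies $\|M_\beta-R\|_F\ge c'n$. -/

import Mathlib

open MeasureTheory ProbabilityTheory Filter Topology Asymptotics
open scoped ENNReal NNReal Matrix

attribute [local instance] Matrix.frobeniusNormedAddCommGroup

/-! ### The clustered Gaussian input process -/

/-- The centred isotropic Gaussian law on `ℝ^d` all of whose coordinates are independent with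
standard deviation `σ` (that is, with covariance matrix `σ² I_d`). -/
noncomputable def isoGaussian (d : ℕ) (σ : ℝ) : Measure (Fin d → ℝ) :=
  Measure.pi fun _ : Fin d => gaussianReal 0 (⟨σ ^ 2, sq_nonneg σ⟩ : ℝ≥0)

/-- A sample: the `C` cluster centres `c_i` and the `C * b` deviations `r_{ij}`, all in `ℝ^d`. -/
abbrev ClusterSample (C b d : ℕ) : Type :=
  (Fin C → Fin d → ℝ) × (Fin C → Fin b → Fin d → ℝ)

/-- The law of the sample: all `c_i` and all `r_{ij}` are independent, the coordinates of `c_i`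
have standard deviation `1 / √d` and those of `r_{ij}` have standard deviation `Δ / √d`. -/
noncomputable def clusterMeasure (C b d : ℕ) (Δ : ℝ) : Measure (ClusterSample C b d) :=
  (Measure.pi fun _ : Fin C => isoGaussian d (1 / √(d : ℝ))).prod
    (Measure.pi fun _ : Fin C => Measure.pi fun _ : Fin b => isoGaussian d (Δ / √(d : ℝ)))

/-- The input matrix `Q`; its row with index `(i, j)` is `z_{ij} = c_i + r_{ij}`. -/
def inputMatrix {C b d : ℕ} (ω : ClusterSample C b d) : Matrix (Fin C × Fin b) (Fin d) ℝ :=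
  Matrix.of fun ij k => ω.1 ij.1 k + ω.2 ij.1 ij.2 k

/-- The attention matrix `M_β = exp (β Q Qᵀ)`, with the exponential taken entry by entry. -/
noncomputable def attentionMatrix {C b d : ℕ} (β : ℝ) (ω : ClusterSample C b d) :
    Matrix (Fin C × Fin b) (Fin C × Fin b) ℝ :=
  (β • (inputMatrix ω * (inputMatrix ω)ᵀ)).map Real.exp

/-- The parameter regime, for `n = C * b` inputs in `C` clusters of `b` elements each:
`C = Ω(n)`, `d = Ω(log^{3/2} n)`, `0 ≤ Δ ≤ O(1 / log^{1/4} n)` and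
`(1 - Δ²) log n ≤ β ≤ O(log n)`. The numbers `γ`, `κ`, `K`, `L` are the constants hidden in the
four asymptotic bounds. -/
structure ClusterRegime (γ κ K L : ℝ) (C b d : ℕ) (Δ β : ℝ) : Prop where
  clusters : γ * ((C * b : ℕ) : ℝ) ≤ C
  dim : κ * Real.log ((C * b : ℕ) : ℝ) ^ (3 / 2 : ℝ) ≤ d
  dist_nonneg : 0 ≤ Δ
  dist_le : Δ ≤ K / Real.log ((C * b : ℕ) : ℝ) ^ (1 / 4 : ℝ)
  temp_ge : (1 - Δ ^ 2) * Real.log ((C * b : ℕ) : ℝ) ≤ β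
  temp_le : β ≤ L * Real.log ((C * b : ℕ) : ℝ)

/-! ### Flat block butterfly + low-rank matrices

A matrix of size `N * b`, divided into `N × N` blocks of size `b × b`, is indexed by
`Fin N × Fin b` (block index, position inside the block). -/

/-- Block butterfly factor matrices of stride `k` (even, dividing `N`) and block size `b`. Such a
matrix is block diagonal with `N / k` diagonal pieces, each made of `k × k` blocks and of the form
`[D₁ D₂; D₃ D₄]` with every `Dᵢ` a block diagonal matrix of `k/2 × k/2` blocks. So the block
`(I, J)` is arbitrary if `I` and `J` lie in the same piece and agree modulo `k/2`, and it is zero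
otherwise. -/
def IsBlockButterflyFactor (N b k : ℕ)
    (B : Matrix (Fin N × Fin b) (Fin N × Fin b) ℝ) : Prop :=
  k ∣ N ∧ ∀ I J : Fin N, ∀ p q : Fin b,
    ¬ ((I : ℕ) / k = (J : ℕ) / k ∧ (I : ℕ) % (k / 2) = (J : ℕ) % (k / 2)) → B (I, p) (J, q) = 0

/-- Flat block butterfly matrices of maximum stride `2 ^ m` and block size `b`: those of the form
`I + lam (B₂ + B₄ + ⋯ + B_{2^m})`, with `B_k` a block butterfly factor matrix of stride `k`. -/
def IsFlatBlockButterfly (N b m : ℕ)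
    (F : Matrix (Fin N × Fin b) (Fin N × Fin b) ℝ) : Prop :=
  1 ≤ m ∧ ∃ (lam : ℝ) (B : ℕ → Matrix (Fin N × Fin b) (Fin N × Fin b) ℝ),
    (∀ i ∈ Finset.Icc 1 m, IsBlockButterflyFactor N b (2 ^ i) (B i)) ∧
    F = 1 + lam • ∑ i ∈ Finset.Icc 1 m, B i

/-- `R = F + U Vᵀ` with `F` flat block butterfly and `U`, `V` having `r` columns. -/
def IsFlatBlockButterflyAddLowRank (N b m r : ℕ)
    (R : Matrix (Fin N × Fin b) (Fin N × Fin b) ℝ) : Prop :=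
  ∃ (F : Matrix (Fin N × Fin b) (Fin N × Fin b) ℝ) (U V : Matrix (Fin N × Fin b) (Fin r) ℝ),
    IsFlatBlockButterfly N b m F ∧ R = F + U * Vᵀ

/-- The number of parameters: one for `lam`; for each of the `m` factors, two `b × b` blocks in
each of the `N` block rows; and the entries of `U` and `V`. -/
def flatBlockButterflyLowRankParams (N b m r : ℕ) : ℕ :=
  1 + m * (2 * N * b ^ 2) + 2 * ((N * b) * r)

/-- The number of nonzero entries of a matrix. -/
noncomputable def numNonzeros {ι : Type*} (R : Matrix ι ι ℝ) : ℕ :=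
  Set.ncard {p : ι × ι | R p.1 p.2 ≠ 0}

/-! ### Exponential moments of Gaussian vectors -/

/-! Write `s = √(log n)`. Outside the diagonal blocks, `β² / d = O(s)` makes exponential moments of
`β z_p ⬝ᵥ z_q` at most `exp (O(s)) = n^{o(1)}`, so Markov's inequality gives that part of the matrix
Frobenius norm at most `n^{1+o(1)}` (`lintegral_exp_inputRow_dotProduct_le`,
`measure_norm_offBlock_ge_le`). The diagonal blocks carry the large entries, of order up to `exp β`.

Upper bound: a single stride 2 factor reproduces all diagonal blocks exactly. Elsewhere `exp` is
replaced by a Taylor polynomial, which has low rank because powers of scalar products are scalar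
products of tensor powers (`exists_expTaylor_factorization`). Degree `O(s)` suffices if `d ≤ s ^ 6`;
for larger `d` the constant polynomial does.

Low-rank lower bounds: in all but a few clusters the diagonal block, or one diagonal entry of it,
has singular values at least `n^{1/2+δ}`. A block diagonal matrix made of these is at distance
`n^{1/2+δ} √(c n / 2)` from matrices of too small rank (`Matrix.sq_mul_le_frobenius_norm_sub_sq`),
which beats the off-block norm. For whole blocks, `cluster_block_ge` bounds the entrywise
exponential of the Gram matrix of the deviations below by `β` times this Gram matrix, which is close
to `Δ² I`.

Sparse lower bound: flipping the sign of one cluster preserves the law, so signs of scalar products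
between clusters are uncorrelated. By Chebyshev a positive fraction of the entries is at least `1`,
and a sparse matrix misses most of them. -/

theorem isoGaussian_eq_pi (d : ℕ) (σ : ℝ) :
    isoGaussian d σ = Measure.pi fun _ : Fin d => gaussianReal 0 (σ ^ 2).toNNReal := by
  have h : (⟨σ ^ 2, sq_nonneg σ⟩ : ℝ≥0) = (σ ^ 2).toNNReal :=
    NNReal.eq (Real.coe_toNNReal _ (sq_nonneg σ)).symm
  unfold isoGaussian
  exact congrArg (fun v => Measure.pi fun _ : Fin d => gaussianReal 0 v) h

instance isoGaussian.instIsProbabilityMeasure (d : ℕ) (σ : ℝ) :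
    IsProbabilityMeasure (isoGaussian d σ) := by
  rw [isoGaussian_eq_pi]; infer_instance

theorem lintegral_exp_mul_gaussianReal (v : ℝ≥0) (t : ℝ) :
    ∫⁻ x, ENNReal.ofReal (Real.exp (t * x)) ∂gaussianReal 0 v
      = ENNReal.ofReal (Real.exp (v * t ^ 2 / 2)) := by
  rw [← ofReal_integral_eq_lintegral_ofReal (integrable_exp_mul_gaussianReal t)
    (ae_of_all _ fun _ => (Real.exp_pos _).le)]
  have := congrFun (mgf_id_gaussianReal (μ := 0) (v := v)) t
  simp only [mgf, id] at this
  rw [this]; simp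

theorem lintegral_exp_mul_sq_stdGaussian {w : ℝ} (hw : w < 1 / 2) :
    ∫⁻ x, ENNReal.ofReal (Real.exp (w * x ^ 2)) ∂gaussianReal 0 1
      = ENNReal.ofReal (√(1 - 2 * w))⁻¹ := by
  have hb : 0 < 1 / 2 - w := by linarith
  rw [gaussianReal_of_var_ne_zero _ one_ne_zero, lintegral_withDensity_eq_lintegral_mul _
    (measurable_gaussianPDF 0 1) (by fun_prop)]
  have h : ∀ x : ℝ, (gaussianPDF 0 1 * fun x => ENNReal.ofReal (Real.exp (w * x ^ 2))) x
      = ENNReal.ofReal ((√(2 * Real.pi))⁻¹ * Real.exp (-(1 / 2 - w) * x ^ 2)) := by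
    intro x
    rw [Pi.mul_apply, gaussianPDF, ← ENNReal.ofReal_mul (gaussianPDFReal_nonneg _ _ _),
      gaussianPDFReal]
    simp only [NNReal.coe_one, mul_one, sub_zero]
    rw [mul_assoc, ← Real.exp_add]
    congr 3; ring
  simp_rw [h]
  rw [← ofReal_integral_eq_lintegral_ofReal ((integrable_exp_neg_mul_sq hb).const_mul _)
    (ae_of_all _ fun _ => by positivity), integral_const_mul, integral_gaussian,
    ← Real.sqrt_inv, ← Real.sqrt_inv, ← Real.sqrt_mul (by positivity)]
  congr 2
  have h1 : 1 - 2 * w ≠ 0 := by linarith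
  have h2 : 1 / 2 - w ≠ 0 := by linarith
  have := Real.pi_ne_zero
  field_simp

theorem lintegral_exp_mul_sq_gaussianReal {σ s : ℝ} (hs : s * σ ^ 2 < 1 / 2) :
    ∫⁻ x, ENNReal.ofReal (Real.exp (s * x ^ 2))
        ∂gaussianReal 0 (σ ^ 2).toNNReal
      = ENNReal.ofReal (√(1 - 2 * (s * σ ^ 2)))⁻¹ := by
  have h := gaussianReal_map_const_mul (μ := 0) (v := 1) σ
  have hv : (NNReal.mk (σ ^ 2) (sq_nonneg _)) = (σ ^ 2).toNNReal :=
    NNReal.eq (Real.coe_toNNReal _ (sq_nonneg σ)).symm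
  rw [mul_zero, mul_one, hv] at h
  have h' : gaussianReal 0 (σ ^ 2).toNNReal = (gaussianReal 0 1).map (σ * ·) := h.symm
  rw [h', lintegral_map (by fun_prop) (by fun_prop), ← lintegral_exp_mul_sq_stdGaussian hs]
  congr with x
  congr 2; ring

/-- Equivalent to `exp (-2w) ≤ 1 - w`, which follows from `1 + 2w ≤ exp (2w)` and `(1 + 2w)(1 - w) ≥
1`. -/
theorem inv_sqrt_one_sub_le {w : ℝ} (h0 : 0 ≤ w) (h1 : w ≤ 1 / 2) :
    (√(1 - w))⁻¹ ≤ Real.exp w := by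
  have h2 : 0 < 1 - w := by linarith
  rw [inv_le_comm₀ (Real.sqrt_pos.2 h2) (Real.exp_pos _), ← Real.exp_neg]
  apply Real.le_sqrt_of_sq_le
  rw [← Real.exp_nat_mul]
  have h3 : Real.exp (2 * w) * Real.exp ((2 : ℕ) * -w) = 1 := by
    rw [← Real.exp_add]; simp
  have h4 := Real.add_one_le_exp (2 * w)
  have h5 := Real.exp_pos ((2 : ℕ) * -w)
  nlinarith [mul_nonneg h0 (by linarith : (0 : ℝ) ≤ 1 - 2 * w)]

/-- After taking logarithms this is `2w - 2w² ≤ log (1 + 2w)`, a consequence of `log (1 + x) ≥ 2x /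
(x + 2)`. The quadratic term yields the Gaussian lower tail of squared norms. -/
theorem inv_sqrt_one_add_two_mul_le {w : ℝ} (h0 : 0 ≤ w) :
    (√(1 + 2 * w))⁻¹ ≤ Real.exp (-w + w ^ 2) := by
  have h2 : 0 < 1 + 2 * w := by linarith
  rw [inv_le_comm₀ (Real.sqrt_pos.2 h2) (Real.exp_pos _), ← Real.exp_neg]
  apply Real.le_sqrt_of_sq_le
  rw [← Real.exp_nat_mul, ← Real.le_log_iff_exp_le h2]
  refine le_trans ?_ (Real.le_log_one_add_of_nonneg (by positivity))
  rw [le_div_iff₀ (by positivity)]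
  push_cast
  nlinarith [pow_nonneg h0 3]

theorem lintegral_prod_isoGaussian {d : ℕ} (σ : ℝ) (f : Fin d → ℝ → ℝ≥0∞)
    (hf : ∀ i, Measurable (f i)) :
    ∫⁻ x, ∏ i, f i (x i) ∂isoGaussian d σ
      = ∏ i, ∫⁻ x, f i x ∂gaussianReal 0 (σ ^ 2).toNNReal := by
  rw [isoGaussian_eq_pi]
  rw [lintegral_prod_eq_prod_lintegral_of_indepFun Finset.univ
    (fun (i : Fin d) (x : Fin d → ℝ) => f i (x i))
    (iIndepFun_pi fun i => (hf i).aemeasurable) (fun i => (hf i).comp (measurable_pi_apply i))]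
  refine Finset.prod_congr rfl fun i _ => ?_
  exact (measurePreserving_eval (fun _ : Fin d => gaussianReal 0 (σ ^ 2).toNNReal) i).lintegral_comp (hf i)

theorem ofReal_exp_sum {ι : Type*} (s : Finset ι) (f : ι → ℝ) :
    ENNReal.ofReal (Real.exp (∑ i ∈ s, f i)) = ∏ i ∈ s, ENNReal.ofReal (Real.exp (f i)) := by
  rw [Real.exp_sum, ENNReal.ofReal_prod_of_nonneg fun i _ => (Real.exp_pos _).le]

theorem lintegral_exp_dotProduct_isoGaussian {d : ℕ} (σ t : ℝ) (y : Fin d → ℝ) :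
    ∫⁻ x, ENNReal.ofReal (Real.exp (t * x ⬝ᵥ y)) ∂isoGaussian d σ
      = ENNReal.ofReal (Real.exp (t ^ 2 * σ ^ 2 / 2 * y ⬝ᵥ y)) := by
  have h : ∀ x : Fin d → ℝ, ENNReal.ofReal (Real.exp (t * x ⬝ᵥ y))
      = ∏ i, ENNReal.ofReal (Real.exp ((t * y i) * x i)) := by
    intro x
    rw [← ofReal_exp_sum, dotProduct, Finset.mul_sum]
    congr 3 with i; ring
  simp_rw [h]
  rw [lintegral_prod_isoGaussian σ (fun i x => ENNReal.ofReal (Real.exp ((t * y i) * x)))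
    (by fun_prop)]
  simp_rw [lintegral_exp_mul_gaussianReal]
  rw [← ofReal_exp_sum, dotProduct, Finset.mul_sum]
  congr 3 with i
  rw [Real.coe_toNNReal _ (sq_nonneg σ)]; ring

theorem lintegral_exp_normSq_isoGaussian {d : ℕ} {σ s : ℝ} (hs : s * σ ^ 2 < 1 / 2) :
    ∫⁻ x, ENNReal.ofReal (Real.exp (s * x ⬝ᵥ x)) ∂isoGaussian d σ
      = ENNReal.ofReal ((√(1 - 2 * (s * σ ^ 2)))⁻¹ ^ d) := by
  have h : ∀ x : Fin d → ℝ, ENNReal.ofReal (Real.exp (s * x ⬝ᵥ x))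
      = ∏ i, ENNReal.ofReal (Real.exp (s * x i ^ 2)) := by
    intro x
    rw [← ofReal_exp_sum, dotProduct, Finset.mul_sum]
    congr 3 with i; ring
  simp_rw [h]
  rw [lintegral_prod_isoGaussian σ (fun i x => ENNReal.ofReal (Real.exp (s * x ^ 2)))
    (by fun_prop)]
  simp_rw [lintegral_exp_mul_sq_gaussianReal hs]
  rw [Finset.prod_const, Finset.card_univ, Fintype.card_fin, ENNReal.ofReal_pow (by positivity)]

@[fun_prop]
theorem Measurable.dotProduct_fin {α : Type*} [MeasurableSpace α] {d : ℕ} {f g : α → Fin d → ℝ}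
    (hf : Measurable f) (hg : Measurable g) : Measurable fun x => f x ⬝ᵥ g x := by
  unfold dotProduct
  exact Finset.measurable_sum _ fun i _ =>
    ((measurable_pi_apply i).comp hf).mul ((measurable_pi_apply i).comp hg)

/-- Exponential moments of the scalar product of two independent Gaussian vectors. -/
theorem lintegral_exp_dotProduct_le {d : ℕ} {σ τ t : ℝ} (h : t ^ 2 * σ ^ 2 * τ ^ 2 ≤ 1 / 2) :
    ∫⁻ p, ENNReal.ofReal (Real.exp (t * p.1 ⬝ᵥ p.2)) ∂(isoGaussian d σ).prod (isoGaussian d τ)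
      ≤ ENNReal.ofReal (Real.exp (d * (t ^ 2 * σ ^ 2 * τ ^ 2))) := by
  -- For a fixed second vector the scalar product is a centred Gaussian; what remains is an
  -- exponential moment of the squared norm of that vector.
  rw [lintegral_prod_symm' _ (by fun_prop)]
  simp_rw [lintegral_exp_dotProduct_isoGaussian]
  rw [lintegral_exp_normSq_isoGaussian (by linarith)]
  apply ENNReal.ofReal_le_ofReal
  rw [Real.exp_nat_mul]
  gcongr
  rw [show 2 * (t ^ 2 * σ ^ 2 / 2 * τ ^ 2) = t ^ 2 * σ ^ 2 * τ ^ 2 by ring]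
  exact inv_sqrt_one_sub_le (by positivity) h

/-- Chernoff's bound in terms of the exponential moment. -/
theorem measure_le_exp_of_lintegral_exp {α : Type*} [MeasurableSpace α] (μ : Measure α)
    {f : α → ℝ} (hf : Measurable f) {a A : ℝ}
    (h : ∫⁻ x, ENNReal.ofReal (Real.exp (f x)) ∂μ ≤ ENNReal.ofReal (Real.exp A)) :
    μ {x | a ≤ f x} ≤ ENNReal.ofReal (Real.exp (A - a)) := by
  have h1 : {x | a ≤ f x} ⊆ {x | ENNReal.ofReal (Real.exp a) ≤ ENNReal.ofReal (Real.exp (f x))} :=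
    fun x hx => ENNReal.ofReal_le_ofReal (Real.exp_le_exp.2 hx)
  refine (measure_mono h1).trans ((meas_ge_le_lintegral_div (by fun_prop)
    (by simpa using Real.exp_pos a) ENNReal.ofReal_ne_top).trans ?_)
  rw [Real.exp_sub, ENNReal.ofReal_div_of_pos (Real.exp_pos _)]
  gcongr

/-- Chernoff with parameter `ε d / (2ρ)`. Leaving the event multiplied by this parameter lets `ε` be
negative, which covers the lower tail. -/
theorem measure_dotProduct_ge_le {d : ℕ} (hd : 0 < d) {σ τ ρ ε : ℝ} (hρ : 0 < ρ)
    (hστ : σ ^ 2 * τ ^ 2 ≤ (ρ / d) ^ 2) (hε1 : ε ^ 2 ≤ 1) :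
    (isoGaussian d σ).prod (isoGaussian d τ) {p | ε ^ 2 / 2 * d ≤ ε * d / (2 * ρ) * p.1 ⬝ᵥ p.2}
      ≤ ENNReal.ofReal (Real.exp (-(d * ε ^ 2 / 4))) := by
  have hd' : (0 : ℝ) < d := by exact_mod_cast hd
  have key : (ε * d / (2 * ρ)) ^ 2 * σ ^ 2 * τ ^ 2 ≤ ε ^ 2 / 4 := by
    rw [mul_assoc]
    calc (ε * d / (2 * ρ)) ^ 2 * (σ ^ 2 * τ ^ 2)
        ≤ (ε * d / (2 * ρ)) ^ 2 * (ρ / d) ^ 2 := by gcongr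
      _ = ε ^ 2 / 4 := by field_simp; norm_num
  refine (measure_le_exp_of_lintegral_exp _ (A := d * (ε ^ 2 / 4)) (by fun_prop)
    ((lintegral_exp_dotProduct_le (by linarith)).trans ?_)).trans (le_of_eq ?_)
  · gcongr
  · congr 2; ring

/-- Chernoff with parameter `-ε / (2σ²)`. -/
theorem measure_normSq_le_le {d : ℕ} {σ ε : ℝ} (hσ : 0 < σ) (hε0 : 0 ≤ ε) :
    (isoGaussian d σ) {x | x ⬝ᵥ x ≤ (1 - ε) * (d * σ ^ 2)}
      ≤ ENNReal.ofReal (Real.exp (-(d * ε ^ 2 / 4))) := by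
  have h1 : {x : Fin d → ℝ | x ⬝ᵥ x ≤ (1 - ε) * (d * σ ^ 2)}
      ⊆ {x | -(ε / 2 * ((1 - ε) * d)) ≤ -(ε / (2 * σ ^ 2)) * x ⬝ᵥ x} := by
    intro x hx
    simp only [Set.mem_ofPred_eq] at hx ⊢
    have : ε / (2 * σ ^ 2) * x ⬝ᵥ x ≤ ε / (2 * σ ^ 2) * ((1 - ε) * (d * σ ^ 2)) := by gcongr
    have h2 : ε / (2 * σ ^ 2) * ((1 - ε) * (d * σ ^ 2)) = ε / 2 * ((1 - ε) * d) := by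
      field_simp
    linarith
  have e1 : -(ε / (2 * σ ^ 2)) * σ ^ 2 = -(ε / 2) := by field_simp
  refine (measure_mono h1).trans ((measure_le_exp_of_lintegral_exp _
    (A := d * (-(ε / 2) + (ε / 2) ^ 2)) (by fun_prop) ?_).trans (le_of_eq ?_))
  · rw [lintegral_exp_normSq_isoGaussian (by rw [e1]; linarith), e1]
    apply ENNReal.ofReal_le_ofReal
    rw [Real.exp_nat_mul]
    gcongr
    rw [show 1 - 2 * -(ε / 2) = 1 + 2 * (ε / 2) by ring]
    exact inv_sqrt_one_add_two_mul_le (by positivity)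
  · congr 2; ring

/-! ### Marginals of the clustered input process -/

theorem MeasureTheory.measurePreserving_pi_pair {ι : Type*} [Fintype ι] {X : ι → Type*}
    [∀ i, MeasurableSpace (X i)] (μ : ∀ i, Measure (X i)) [∀ i, IsProbabilityMeasure (μ i)]
    {i j : ι} (hij : i ≠ j) :
    MeasurePreserving (fun x : ∀ i, X i => (x i, x j)) (Measure.pi μ) ((μ i).prod (μ j)) := by
  refine ⟨(measurable_pi_apply i).prodMk (measurable_pi_apply j), ?_⟩
  have hI := (iIndepFun_pi (μ := μ) (X := fun i (x : X i) => x)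
    fun i => measurable_id.aemeasurable).indepFun hij
  rw [indepFun_iff_map_prod_eq_prod_map_map (measurable_pi_apply i).aemeasurable
    (measurable_pi_apply j).aemeasurable] at hI
  rw [hI]
  exact congrArg₂ _ (measurePreserving_eval μ i).map_eq (measurePreserving_eval μ j).map_eq

section Marginals

variable {C b d : ℕ} {Δ : ℝ}

instance clusterMeasure.instIsProbabilityMeasure : IsProbabilityMeasure (clusterMeasure C b d Δ) := by
  unfold clusterMeasure; infer_instance

theorem measurePreserving_centre (i : Fin C) :
    MeasurePreserving (fun ω : ClusterSample C b d => ω.1 i) (clusterMeasure C b d Δ)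
      (isoGaussian d (1 / √(d : ℝ))) :=
  (measurePreserving_eval (fun _ : Fin C => isoGaussian d (1 / √(d : ℝ))) i).comp
    measurePreserving_fst

theorem measurePreserving_deviation (i : Fin C) (j : Fin b) :
    MeasurePreserving (fun ω : ClusterSample C b d => ω.2 i j) (clusterMeasure C b d Δ)
      (isoGaussian d (Δ / √(d : ℝ))) :=
  ((measurePreserving_eval (fun _ : Fin b => isoGaussian d (Δ / √(d : ℝ))) j).comp
    (measurePreserving_eval (fun _ : Fin C => Measure.pi fun _ : Fin b =>
      isoGaussian d (Δ / √(d : ℝ))) i)).comp measurePreserving_snd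

theorem measurePreserving_centre_centre {i i' : Fin C} (h : i ≠ i') :
    MeasurePreserving (fun ω : ClusterSample C b d => (ω.1 i, ω.1 i')) (clusterMeasure C b d Δ)
      ((isoGaussian d (1 / √(d : ℝ))).prod (isoGaussian d (1 / √(d : ℝ)))) :=
  (measurePreserving_pi_pair (fun _ : Fin C => isoGaussian d (1 / √(d : ℝ))) h).comp
    measurePreserving_fst

theorem measurePreserving_centre_deviation (i i' : Fin C) (j : Fin b) :
    MeasurePreserving (fun ω : ClusterSample C b d => (ω.1 i, ω.2 i' j)) (clusterMeasure C b d Δ)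
      ((isoGaussian d (1 / √(d : ℝ))).prod (isoGaussian d (Δ / √(d : ℝ)))) :=
  (measurePreserving_eval (fun _ : Fin C => isoGaussian d (1 / √(d : ℝ))) i).prod
    ((measurePreserving_eval (fun _ : Fin b => isoGaussian d (Δ / √(d : ℝ))) j).comp
    (measurePreserving_eval (fun _ : Fin C => Measure.pi fun _ : Fin b =>
      isoGaussian d (Δ / √(d : ℝ))) i'))

theorem measurePreserving_deviation_deviation {i i' : Fin C} {j j' : Fin b}
    (h : i ≠ i' ∨ j ≠ j') :
    MeasurePreserving (fun ω : ClusterSample C b d => (ω.2 i j, ω.2 i' j'))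
      (clusterMeasure C b d Δ)
      ((isoGaussian d (Δ / √(d : ℝ))).prod (isoGaussian d (Δ / √(d : ℝ)))) := by
  by_cases hi : i = i'
  · subst hi
    have hj : j ≠ j' := by simpa using h
    exact ((measurePreserving_pi_pair (fun _ : Fin b => isoGaussian d (Δ / √(d : ℝ))) hj).comp
      (measurePreserving_eval (fun _ : Fin C => Measure.pi fun _ : Fin b =>
        isoGaussian d (Δ / √(d : ℝ))) i)).comp measurePreserving_snd
  · exact (((measurePreserving_eval (fun _ : Fin b => isoGaussian d (Δ / √(d : ℝ))) j).prod
      (measurePreserving_eval (fun _ : Fin b => isoGaussian d (Δ / √(d : ℝ))) j')).comp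
      (measurePreserving_pi_pair (fun _ : Fin C => Measure.pi fun _ : Fin b =>
        isoGaussian d (Δ / √(d : ℝ))) hi)).comp measurePreserving_snd

/-- The input vector `z_{ij} = c_i + r_{ij}`. -/
def inputRow (ω : ClusterSample C b d) (p : Fin C × Fin b) : Fin d → ℝ := ω.1 p.1 + ω.2 p.1 p.2

@[fun_prop]
theorem measurable_centre (i : Fin C) : Measurable fun ω : ClusterSample C b d => ω.1 i :=
  (measurable_pi_apply i).comp measurable_fst

@[fun_prop]
theorem measurable_deviation (i : Fin C) (j : Fin b) :
    Measurable fun ω : ClusterSample C b d => ω.2 i j :=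
  (measurable_pi_apply j).comp ((measurable_pi_apply i).comp measurable_snd)

@[fun_prop]
theorem measurable_inputRow (p : Fin C × Fin b) :
    Measurable fun ω : ClusterSample C b d => inputRow ω p :=
  (measurable_centre p.1).add (measurable_deviation p.1 p.2)

theorem attentionMatrix_apply (β : ℝ) (ω : ClusterSample C b d) (p q : Fin C × Fin b) :
    attentionMatrix β ω p q = Real.exp (β * inputRow ω p ⬝ᵥ inputRow ω q) := rfl

/-- Convexity of `exp`. It decouples the four dependent terms of `(c + r) ⬝ᵥ (c' + r')`, at the
price of a factor `4` in `t`. -/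
theorem exp_mul_add_four_le (t x y z w : ℝ) : Real.exp (t * (x + y + z + w)) ≤
    1 / 4 * (Real.exp (4 * t * x) + Real.exp (4 * t * y) + Real.exp (4 * t * z)
      + Real.exp (4 * t * w)) := by
  have h2 : ∀ u v : ℝ, Real.exp (u + v) ≤ (Real.exp (2 * u) + Real.exp (2 * v)) / 2 := by
    intro u v
    have e1 : Real.exp (2 * u) = Real.exp u ^ 2 := by rw [← Real.exp_nat_mul]; simp
    have e2 : Real.exp (2 * v) = Real.exp v ^ 2 := by rw [← Real.exp_nat_mul]; simp
    rw [e1, e2, Real.exp_add]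
    nlinarith [sq_nonneg (Real.exp u - Real.exp v)]
  have a1 := h2 (t * x + t * y) (t * z + t * w)
  have a2 := h2 (2 * (t * x)) (2 * (t * y))
  have a3 := h2 (2 * (t * z)) (2 * (t * w))
  have e0 : t * (x + y + z + w) = t * x + t * y + (t * z + t * w) := by ring
  have e1 : ∀ s : ℝ, 2 * (2 * (t * s)) = 4 * t * s := fun s => by ring
  rw [e1, e1] at a2 a3
  rw [e0]
  rw [mul_add, mul_add] at a1
  linarith

theorem one_div_sqrt_sq (d : ℕ) : (1 / √(d : ℝ)) ^ 2 = 1 / d := by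
  rw [div_pow, one_pow, Real.sq_sqrt (Nat.cast_nonneg d)]

theorem div_sqrt_sq (Δ : ℝ) (d : ℕ) : (Δ / √(d : ℝ)) ^ 2 = Δ ^ 2 / d := by
  rw [div_pow, Real.sq_sqrt (Nat.cast_nonneg d)]

/-- Exponential moments of the scalar products of inputs from different clusters. -/
theorem lintegral_exp_inputRow_dotProduct_le {t : ℝ} (hd : 0 < d) (hΔ0 : 0 ≤ Δ) (hΔ1 : Δ ≤ 1)
    (ht : (4 * t / d) ^ 2 ≤ 1 / 2) {p q : Fin C × Fin b} (hpq : p.1 ≠ q.1) :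
    ∫⁻ ω, ENNReal.ofReal (Real.exp (t * inputRow ω p ⬝ᵥ inputRow ω q)) ∂clusterMeasure C b d Δ
      ≤ ENNReal.ofReal (Real.exp (16 * t ^ 2 / d)) := by
  have hd' : (0 : ℝ) < d := by exact_mod_cast hd
  have hΔ2 : Δ ^ 2 ≤ 1 := pow_le_one₀ hΔ0 hΔ1
  -- Since `Δ ≤ 1`, the same bound serves centre-centre, centre-deviation and deviation-deviation
  -- products.
  have base : ∀ (σ τ : ℝ), σ ^ 2 * τ ^ 2 ≤ 1 / d ^ 2 →
      ∫⁻ p, ENNReal.ofReal (Real.exp (4 * t * p.1 ⬝ᵥ p.2)) ∂(isoGaussian d σ).prod (isoGaussian d τ)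
        ≤ ENNReal.ofReal (Real.exp (16 * t ^ 2 / d)) := by
    intro σ τ h
    have h1 : (4 * t) ^ 2 * σ ^ 2 * τ ^ 2 ≤ (4 * t / d) ^ 2 := by
      rw [mul_assoc, div_pow]
      calc (4 * t) ^ 2 * (σ ^ 2 * τ ^ 2) ≤ (4 * t) ^ 2 * (1 / d ^ 2) := by gcongr
        _ = _ := by ring
    refine (lintegral_exp_dotProduct_le (h1.trans ht)).trans (ENNReal.ofReal_le_ofReal ?_)
    apply Real.exp_le_exp.2
    calc (d : ℝ) * ((4 * t) ^ 2 * σ ^ 2 * τ ^ 2) ≤ d * (4 * t / d) ^ 2 := by gcongr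
      _ = _ := by field_simp; ring
  have b1 : (1 / √(d : ℝ)) ^ 2 * (1 / √(d : ℝ)) ^ 2 ≤ 1 / (d : ℝ) ^ 2 := by
    rw [one_div_sqrt_sq]; apply le_of_eq; field_simp
  have b2 : (1 / √(d : ℝ)) ^ 2 * (Δ / √(d : ℝ)) ^ 2 ≤ 1 / (d : ℝ) ^ 2 := by
    rw [one_div_sqrt_sq, div_sqrt_sq, div_mul_div_comm, one_mul, ← sq]; gcongr
  have b3 : (Δ / √(d : ℝ)) ^ 2 * (Δ / √(d : ℝ)) ^ 2 ≤ 1 / (d : ℝ) ^ 2 := by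
    rw [div_sqrt_sq, div_mul_div_comm, ← sq, ← sq]
    gcongr
    exact pow_le_one₀ (by positivity) hΔ2
  have m1 := ((measurePreserving_centre_centre (b := b) (d := d) (Δ := Δ) hpq).lintegral_comp
    (f := fun u => ENNReal.ofReal (Real.exp (4 * t * u.1 ⬝ᵥ u.2))) (by fun_prop)).trans_le
    (base _ _ b1)
  have m2 := ((measurePreserving_centre_deviation (d := d) (Δ := Δ) p.1 q.1 q.2).lintegral_comp
    (f := fun u => ENNReal.ofReal (Real.exp (4 * t * u.1 ⬝ᵥ u.2))) (by fun_prop)).trans_le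
    (base _ _ b2)
  have m3 := ((measurePreserving_centre_deviation (d := d) (Δ := Δ) q.1 p.1 p.2).lintegral_comp
    (f := fun u => ENNReal.ofReal (Real.exp (4 * t * u.1 ⬝ᵥ u.2))) (by fun_prop)).trans_le
    (base _ _ b2)
  have m4 := ((measurePreserving_deviation_deviation (d := d) (Δ := Δ) (j := p.2) (j' := q.2)
    (Or.inl hpq)).lintegral_comp
    (f := fun u => ENNReal.ofReal (Real.exp (4 * t * u.1 ⬝ᵥ u.2))) (by fun_prop)).trans_le
    (base _ _ b3)
  have hsum : ∀ ω : ClusterSample C b d,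
      ENNReal.ofReal (Real.exp (t * inputRow ω p ⬝ᵥ inputRow ω q)) ≤ ENNReal.ofReal (1 / 4) *
      (ENNReal.ofReal (Real.exp (4 * t * ω.1 p.1 ⬝ᵥ ω.1 q.1))
      + ENNReal.ofReal (Real.exp (4 * t * ω.1 p.1 ⬝ᵥ ω.2 q.1 q.2))
      + ENNReal.ofReal (Real.exp (4 * t * ω.1 q.1 ⬝ᵥ ω.2 p.1 p.2))
      + ENNReal.ofReal (Real.exp (4 * t * ω.2 p.1 p.2 ⬝ᵥ ω.2 q.1 q.2))) := by
    intro ω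
    rw [← ENNReal.ofReal_add (by positivity) (by positivity), ← ENNReal.ofReal_add (by positivity)
      (by positivity), ← ENNReal.ofReal_add (by positivity) (by positivity),
      ← ENNReal.ofReal_mul (by norm_num)]
    apply ENNReal.ofReal_le_ofReal
    have e : inputRow ω p ⬝ᵥ inputRow ω q = ω.1 p.1 ⬝ᵥ ω.1 q.1 + ω.1 p.1 ⬝ᵥ ω.2 q.1 q.2
        + ω.1 q.1 ⬝ᵥ ω.2 p.1 p.2 + ω.2 p.1 p.2 ⬝ᵥ ω.2 q.1 q.2 := by
      simp only [inputRow, add_dotProduct, dotProduct_add]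
      rw [dotProduct_comm (ω.2 p.1 p.2) (ω.1 q.1)]
      ring
    rw [e]
    exact exp_mul_add_four_le _ _ _ _ _
  refine (lintegral_mono hsum).trans ?_
  rw [lintegral_const_mul _ (by fun_prop), lintegral_add_left (by fun_prop),
    lintegral_add_left (by fun_prop), lintegral_add_left (by fun_prop)]
  refine (mul_le_mul_right (add_le_add (add_le_add (add_le_add m1 m2) m3) m4) _).trans ?_
  rw [← ENNReal.ofReal_add (by positivity) (by positivity), ← ENNReal.ofReal_add (by positivity)
      (by positivity), ← ENNReal.ofReal_add (by positivity) (by positivity),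
      ← ENNReal.ofReal_mul (by norm_num)]
  apply ENNReal.ofReal_le_ofReal
  linarith

end Marginals

/-! ### Markov's inequality for sums and uniform rates -/

theorem measure_sum_ge_le {α ι : Type*} [MeasurableSpace α] (μ : Measure α) (s : Finset ι)
    (f : ι → α → ℝ) (hf : ∀ i, Measurable (f i)) (h0 : ∀ i x, 0 ≤ f i x) {B k : ℝ}
    (hB : ∀ i ∈ s, ∫⁻ x, ENNReal.ofReal (f i x) ∂μ ≤ ENNReal.ofReal B)
    (hk : 0 < k) : μ {x | k ≤ ∑ i ∈ s, f i x} ≤ ENNReal.ofReal (s.card * B / k) := by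
  have h1 : {x | k ≤ ∑ i ∈ s, f i x}
      ⊆ {x | ENNReal.ofReal k ≤ ∑ i ∈ s, ENNReal.ofReal (f i x)} := by
    intro x hx
    change ENNReal.ofReal k ≤ _
    rw [← ENNReal.ofReal_sum_of_nonneg fun i _ => h0 i x]
    exact ENNReal.ofReal_le_ofReal hx
  refine (measure_mono h1).trans ((meas_ge_le_lintegral_div
    (Finset.aemeasurable_fun_sum _ fun i _ => (hf i).ennreal_ofReal.aemeasurable)
    (by simpa using hk) ENNReal.ofReal_ne_top).trans ?_)
  rw [lintegral_finsetSum _ fun i _ => (hf i).ennreal_ofReal, ENNReal.ofReal_div_of_pos hk]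
  gcongr
  refine (Finset.sum_le_sum hB).trans (le_of_eq ?_)
  rw [Finset.sum_const, nsmul_eq_mul, ENNReal.ofReal_mul (by positivity), ENNReal.ofReal_natCast]

open Classical in
theorem measure_card_ge_le {α ι : Type*} [MeasurableSpace α] (μ : Measure α) [Fintype ι]
    (A : ι → Set α) (hA : ∀ i, MeasurableSet (A i)) {p k : ℝ}
    (hp : ∀ i, μ (A i) ≤ ENNReal.ofReal p) (hk : 0 < k) :
    μ {x | k ≤ ((Finset.univ.filter fun i => x ∈ A i).card : ℝ)}
      ≤ ENNReal.ofReal (Fintype.card ι * p / k) := by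
  have h := measure_sum_ge_le (B := p) μ Finset.univ (fun i => (A i).indicator fun _ => (1 : ℝ))
    (fun i => measurable_const.indicator (hA i))
    (fun i x => Set.indicator_nonneg (fun _ _ => zero_le_one) x) (fun i _ => ?_) hk
  · convert h using 4 with x
    · simp [Set.indicator_apply, Finset.sum_boole]
    · rfl
  · have e : ∀ x, ENNReal.ofReal ((A i).indicator (fun _ => (1 : ℝ)) x)
        = (A i).indicator (fun _ => (1 : ℝ≥0∞)) x := by
      intro x
      by_cases hx : x ∈ A i <;> simp [hx]
    simp_rw [e]
    rw [lintegral_indicator_const (hA i), one_mul]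
    exact hp i

/-- Taking for `ρ n` the supremum over all admissible parameters with `C * b = n` makes the bound
valid for every `n`, while convergence only concerns large `n`. -/
theorem exists_uniform_rate {H : ℕ → ℕ → ℕ → ℝ → ℝ → Prop} {v : ℕ → ℕ → ℕ → ℝ → ℝ → ℝ≥0∞}
    {g : ℕ → ℝ} (hg : Tendsto g atTop (𝓝 0))
    (h : ∀ᶠ n in atTop, ∀ (C b d : ℕ) (Δ β : ℝ), C * b = n → H C b d Δ β →
      v C b d Δ β ≤ ENNReal.ofReal (g n)) :
    ∃ ρ : ℕ → ℝ≥0∞, Tendsto ρ atTop (𝓝 0) ∧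
      ∀ (C b d : ℕ) (Δ β : ℝ), H C b d Δ β → v C b d Δ β ≤ ρ (C * b) := by
  refine ⟨fun n => ⨆ (C : ℕ) (b : ℕ) (d : ℕ) (Δ : ℝ) (β : ℝ) (_ : C * b = n) (_ : H C b d Δ β),
    v C b d Δ β, ?_, ?_⟩
  · have hg' : Tendsto (fun n => ENNReal.ofReal (g n)) atTop (𝓝 0) := by
      simpa [Function.comp_def] using (ENNReal.continuous_ofReal.tendsto 0).comp hg
    refine tendsto_of_tendsto_of_tendsto_of_le_of_le' tendsto_const_nhds hg'
      (Eventually.of_forall fun _ => zero_le) (h.mono fun n hn => ?_)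
    simp only [iSup_le_iff]
    exact hn
  · intro C b d Δ β hH
    exact le_iSup_of_le C <| le_iSup_of_le b <| le_iSup_of_le d <| le_iSup_of_le Δ <|
      le_iSup_of_le β <| le_iSup_of_le rfl <| le_iSup_of_le hH le_rfl

/-! ### Frobenius norms and rank -/

section Frobenius

variable {m n : Type*} [Fintype m] [Fintype n]

theorem Matrix.frobenius_norm_sq (A : Matrix m n ℝ) : ‖A‖ ^ 2 = ∑ i, ∑ j, A i j ^ 2 := by
  rw [Matrix.frobenius_norm_def, ← Real.sqrt_eq_rpow, Real.sq_sqrt (by positivity)]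
  simp

theorem Matrix.frobenius_norm_submatrix_le {m' n' : Type*} [Fintype m'] [Fintype n']
    (A : Matrix m n ℝ) {f : m' → m} {g : n' → n} (hf : f.Injective) (hg : g.Injective) :
    ‖A.submatrix f g‖ ≤ ‖A‖ := by
  apply le_of_sq_le_sq _ (norm_nonneg _)
  rw [Matrix.frobenius_norm_sq, Matrix.frobenius_norm_sq, ← Fintype.sum_prod_type',
    ← Fintype.sum_prod_type']
  have := Finset.sum_map (Finset.univ : Finset (m' × n'))
    ⟨Prod.map f g, hf.prodMap hg⟩ (fun p => A p.1 p.2 ^ 2)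
  refine le_trans (le_of_eq this.symm) ?_
  exact Finset.sum_le_sum_of_subset_of_nonneg (Finset.subset_univ _) fun _ _ _ => sq_nonneg _

open Classical in
/-- A matrix all of whose singular values are at least `σ` has distance at least
`σ √(n - rank R)` from `R`. -/
theorem Matrix.sq_mul_le_frobenius_norm_sub_sq (A R : Matrix n n ℝ) (σ : ℝ)
    (hA : ∀ v : n → ℝ, σ ^ 2 * ∑ j, v j ^ 2 ≤ ∑ i, (∑ j, A i j * v j) ^ 2) :
    σ ^ 2 * ((Fintype.card n : ℝ) - R.rank) ≤ ‖A - R‖ ^ 2 := by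
  -- On the kernel of `R`, of dimension `n - rank R`, the matrix `A - R` acts as `A`. Euclidean
  -- space provides an orthonormal basis of this kernel.
  let φ : EuclideanSpace ℝ n →ₗ[ℝ] (n → ℝ) :=
    R.mulVecLin ∘ₗ (WithLp.linearEquiv 2 ℝ (n → ℝ)).toLinearMap
  let K := LinearMap.ker φ
  have hK : (Module.finrank ℝ K : ℝ) = (Fintype.card n : ℝ) - R.rank := by
    have h1 := LinearMap.finrank_range_add_finrank_ker φ
    have h2 : LinearMap.range φ = LinearMap.range R.mulVecLin :=
      LinearMap.range_comp_of_range_eq_top _ (LinearEquiv.range _)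
    rw [h2, finrank_euclideanSpace] at h1
    rw [← h1, Matrix.rank]
    push_cast; ring
  let e := stdOrthonormalBasis ℝ K
  have he : Orthonormal ℝ (fun k => (e k : EuclideanSpace ℝ n)) :=
    e.orthonormal.comp_linearIsometry K.subtypeₗᵢ
  have hin : ∀ (i : n) (x : EuclideanSpace ℝ n),
      inner ℝ x (WithLp.toLp 2 ((A - R) i)) = ∑ j, (A - R) i j * x j := by
    intro i x
    simp [PiLp.inner_apply]
  -- Bessel's inequality for each row: summed over the rows, it bounds `∑ ‖(A - R) e_k‖²` by the
  -- squared Frobenius norm.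
  have hbessel : ∀ i, ∑ k, (∑ j, (A - R) i j * (e k : EuclideanSpace ℝ n) j) ^ 2
      ≤ ∑ j, (A - R) i j ^ 2 := by
    intro i
    have := he.sum_inner_products_le (s := Finset.univ) (WithLp.toLp 2 ((A - R) i))
    simp_rw [hin] at this
    simpa [EuclideanSpace.norm_sq_eq] using this
  have hker : ∀ k, σ ^ 2 ≤ ∑ i, (∑ j, (A - R) i j * (e k : EuclideanSpace ℝ n) j) ^ 2 := by
    intro k
    have h1 : ∑ j, (e k : EuclideanSpace ℝ n) j ^ 2 = 1 := by
      have := he.1 k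
      have h2 := EuclideanSpace.norm_sq_eq (e k : EuclideanSpace ℝ n)
      rw [this] at h2
      simpa using h2.symm
    have h3 : ∀ i, ∑ j, R i j * (e k : EuclideanSpace ℝ n) j = 0 := by
      intro i
      have h4 : φ (e k) = 0 := (e k).2
      exact congrFun h4 i
    have h5 := hA fun j => (e k : EuclideanSpace ℝ n) j
    rw [h1, mul_one] at h5
    refine h5.trans (le_of_eq (Finset.sum_congr rfl fun i _ => ?_))
    simp only [Matrix.sub_apply, sub_mul, Finset.sum_sub_distrib, h3, sub_zero]
  rw [← hK, Matrix.frobenius_norm_sq]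
  calc σ ^ 2 * (Module.finrank ℝ K : ℝ) = ∑ _k : Fin (Module.finrank ℝ K), σ ^ 2 := by
        simp [mul_comm]
    _ ≤ ∑ k, ∑ i, (∑ j, (A - R) i j * (e k : EuclideanSpace ℝ n) j) ^ 2 :=
        Finset.sum_le_sum fun k _ => hker k
    _ = ∑ i, ∑ k, (∑ j, (A - R) i j * (e k : EuclideanSpace ℝ n) j) ^ 2 := Finset.sum_comm
    _ ≤ _ := Finset.sum_le_sum fun i _ => hbessel i

end Frobenius

section Blocks

variable {ι κ : Type*} [DecidableEq ι]

/-- The part of a block matrix outside of the diagonal blocks. -/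
def Matrix.offBlock (M : Matrix (ι × κ) (ι × κ) ℝ) : Matrix (ι × κ) (ι × κ) ℝ :=
  Matrix.of fun p q => if p.1 = q.1 then 0 else M p q

variable [Fintype ι] [Fintype κ]

/-- If many diagonal blocks have large singular values and the off-diagonal part is small,
then there are no good approximations of low rank. -/
theorem Matrix.frobenius_norm_sub_ge_of_blocks (M R : Matrix (ι × κ) (ι × κ) ℝ) (G : Finset ι)
    {J : Type*} [Fintype J] {g : J → κ} (hg : g.Injective) {σ E k : ℝ} (hk : 0 ≤ k)
    (hblock : ∀ i ∈ G, ∀ v : J → ℝ,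
      σ ^ 2 * ∑ j, v j ^ 2 ≤ ∑ j, (∑ j', M (i, g j) (i, g j') * v j') ^ 2)
    (hE : ‖M.offBlock‖ ≤ E) (hrank : k + R.rank ≤ (G.card : ℝ) * Fintype.card J) :
    σ * √k - E ≤ ‖M - R‖ := by
  let f : G × J → ι × κ := fun x => (x.1, g x.2)
  have hf : f.Injective := by
    rintro ⟨x, j⟩ ⟨y, j'⟩ h
    simp only [f, Prod.mk.injEq] at h
    exact Prod.ext (Subtype.ext h.1) (hg h.2)
  -- The block diagonal matrix of the good blocks. Restricting to a submatrix increases neither the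
  -- rank of `R` nor Frobenius norms.
  let D : Matrix (G × J) (G × J) ℝ := M.submatrix f f - M.offBlock.submatrix f f
  have hD : ∀ i i' j j', D (i, j) (i', j') = if i = i' then M (i, g j) (i, g j') else 0 := by
    intro i i' j j'
    by_cases h : i = i'
    · subst h; simp [D, f, Matrix.offBlock]
    · have : (i : ι) ≠ i' := fun h' => h (Subtype.ext h')
      simp [D, f, Matrix.offBlock, h, this]
  have hDσ : ∀ v : G × J → ℝ, σ ^ 2 * ∑ y, v y ^ 2 ≤ ∑ x, (∑ y, D x y * v y) ^ 2 := by
    intro v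
    rw [Fintype.sum_prod_type, Fintype.sum_prod_type, Finset.mul_sum]
    refine Finset.sum_le_sum fun i _ => ?_
    refine (hblock i i.2 fun j => v (i, j)).trans (le_of_eq ?_)
    refine Finset.sum_congr rfl fun j _ => ?_
    rw [Fintype.sum_prod_type, Finset.sum_eq_single i]
    · simp [hD]
    · intro i' _ hi'
      simp [hD, hi'.symm]
    · simp
  have h1 := Matrix.sq_mul_le_frobenius_norm_sub_sq D (R.submatrix f f) σ hDσ
  have h2 : (R.submatrix f f).rank ≤ R.rank := Matrix.rank_submatrix_le R f f
  have h2' : ((R.submatrix f f).rank : ℝ) ≤ R.rank := by exact_mod_cast h2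
  rw [Fintype.card_prod, Fintype.card_coe] at h1
  push_cast at h1
  have h3 : (σ * √k) ^ 2 ≤ ‖D - R.submatrix f f‖ ^ 2 := by
    refine le_trans ?_ h1
    rw [mul_pow, Real.sq_sqrt hk]
    gcongr
    linarith
  have h4 : σ * √k ≤ ‖D - R.submatrix f f‖ :=
    le_of_sq_le_sq h3 (norm_nonneg _)
  have h5 : D - R.submatrix f f = (M - R).submatrix f f - M.offBlock.submatrix f f := by
    ext x y
    simp only [D, Matrix.sub_apply, Matrix.submatrix_apply]
    ring
  have h6 := norm_sub_le ((M - R).submatrix f f) (M.offBlock.submatrix f f)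
  have h7 := Matrix.frobenius_norm_submatrix_le (M - R) hf hf
  have h8 := Matrix.frobenius_norm_submatrix_le M.offBlock hf hf
  rw [← h5] at h6
  linarith

end Blocks

/-- A lower bound for the quadratic form of a matrix bounds its singular values from below. -/
theorem sq_mul_sum_sq_le_of_quadratic_ge {J : Type*} [Fintype J] (B : J → J → ℝ) {σ : ℝ}
    (hσ : 0 ≤ σ) (v : J → ℝ) (h : σ * ∑ j, v j ^ 2 ≤ ∑ j, ∑ j', v j * v j' * B j j') :
    σ ^ 2 * ∑ j, v j ^ 2 ≤ ∑ j, (∑ j', B j j' * v j') ^ 2 := by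
  set s := ∑ j, v j ^ 2 with hs
  have hs0 : 0 ≤ s := Finset.sum_nonneg fun _ _ => sq_nonneg _
  rcases hs0.eq_or_lt with h0 | h0
  · rw [← h0, mul_zero]
    exact Finset.sum_nonneg fun _ _ => sq_nonneg _
  have hcs := Finset.sum_mul_sq_le_sq_mul_sq Finset.univ v fun j => ∑ j', B j j' * v j'
  have e : ∑ j, ∑ j', v j * v j' * B j j' = ∑ j, v j * ∑ j', B j j' * v j' := by
    refine Finset.sum_congr rfl fun j _ => ?_
    rw [Finset.mul_sum]
    exact Finset.sum_congr rfl fun j' _ => by ring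
  rw [e] at h
  have h2 : (σ * s) ^ 2 ≤ s * ∑ j, (∑ j', B j j' * v j') ^ 2 :=
    (pow_le_pow_left₀ (by positivity) h 2).trans hcs
  have h3 : s * (σ ^ 2 * s) ≤ s * ∑ j, (∑ j', B j j' * v j') ^ 2 := by
    rw [show s * (σ ^ 2 * s) = (σ * s) ^ 2 by ring]; exact h2
  exact le_of_mul_le_mul_left h3 h0

/-! ### Entrywise exponentials and their Taylor polynomials -/

/-- The scalar product of the tensor powers `x^{⊗l}` and `y^{⊗l}`. It yields both the positivity of
entrywise powers of Gram matrices and the rank bound `d ^ l`. -/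
theorem dotProduct_pow_eq {d : ℕ} (x y : Fin d → ℝ) (l : ℕ) :
    (x ⬝ᵥ y) ^ l = ∑ f : Fin l → Fin d, (∏ i, x (f i)) * ∏ i, y (f i) := by
  rw [dotProduct, Fintype.sum_pow]
  exact Finset.sum_congr rfl fun f _ => Finset.prod_mul_distrib

/-- The form is the squared norm of `∑ w_j r_j^{⊗l}`. -/
theorem quadratic_dotProduct_pow {J : Type*} [Fintype J] {d : ℕ} (r : J → Fin d → ℝ) (w : J → ℝ)
    (l : ℕ) : 0 ≤ ∑ j, ∑ j', w j * w j' * (r j ⬝ᵥ r j') ^ l := by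
  have h : ∑ j, ∑ j', w j * w j' * (r j ⬝ᵥ r j') ^ l
      = ∑ f : Fin l → Fin d, (∑ j, w j * ∏ i, r j (f i)) ^ 2 := by
    simp_rw [dotProduct_pow_eq, sq, Finset.sum_mul_sum, Finset.mul_sum]
    simp_rw [Finset.sum_comm (t := (Finset.univ : Finset (Fin l → Fin d)))]
    refine Finset.sum_congr rfl fun f _ => Finset.sum_congr rfl fun j _ =>
      Finset.sum_congr rfl fun j' _ => by ring
  rw [h]
  positivity

theorem Real.hasSum_pow_div_factorial (x : ℝ) :
    HasSum (fun l : ℕ => x ^ l / (l.factorial : ℝ)) (Real.exp x) := by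
  rw [Real.exp_eq_exp_ℝ]
  exact NormedSpace.expSeries_div_hasSum_exp x

/-- The entrywise exponential of a Gram matrix dominates the Gram matrix. -/
theorem quadratic_exp_gram_ge {J : Type*} [Fintype J] {d : ℕ} (r : J → Fin d → ℝ) (w : J → ℝ)
    {β : ℝ} (hβ : 0 ≤ β) : β * ∑ j, ∑ j', w j * w j' * (r j ⬝ᵥ r j')
      ≤ ∑ j, ∑ j', w j * w j' * Real.exp (β * r j ⬝ᵥ r j') := by
  have hs : HasSum (fun l : ℕ => ∑ j, ∑ j', w j * w j' *
      ((β * r j ⬝ᵥ r j') ^ l / (l.factorial : ℝ)))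
      (∑ j, ∑ j', w j * w j' * Real.exp (β * r j ⬝ᵥ r j')) :=
    hasSum_sum fun j _ => hasSum_sum fun j' _ => (Real.hasSum_pow_div_factorial _).mul_left _
  have e : ∀ l : ℕ, ∑ j, ∑ j', w j * w j' * ((β * r j ⬝ᵥ r j') ^ l / (l.factorial : ℝ))
      = β ^ l / (l.factorial : ℝ) * ∑ j, ∑ j', w j * w j' * (r j ⬝ᵥ r j') ^ l := by
    intro l
    simp_rw [Finset.mul_sum]
    refine Finset.sum_congr rfl fun j _ => Finset.sum_congr rfl fun j' _ => ?_
    rw [mul_pow]; ring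
  simp_rw [e] at hs
  -- Every term of the exponential series is positive semidefinite, so the linear term alone is a
  -- lower bound.
  have h := le_hasSum hs 1 fun l _ => mul_nonneg (by positivity) (quadratic_dotProduct_pow r w l)
  simpa using h

theorem quadratic_gram_ge {J : Type*} [Fintype J] {d : ℕ} (r : J → Fin d → ℝ) (w : J → ℝ)
    {a e : ℝ} (ha : ∀ j, a ≤ r j ⬝ᵥ r j) (he0 : 0 ≤ e)
    (he : ∀ j j', j ≠ j' → |r j ⬝ᵥ r j'| ≤ e) :
    (a - Fintype.card J * e) * ∑ j, w j ^ 2 ≤ ∑ j, ∑ j', w j * w j' * (r j ⬝ᵥ r j') := by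
  classical
  -- The error is charged on the diagonal too, whence the factor `Fintype.card J` in place of
  -- `Fintype.card J - 1`.
  have h : ∀ j j', (if j = j' then a * w j ^ 2 else 0) - e * (w j ^ 2 + w j' ^ 2) / 2
      ≤ w j * w j' * (r j ⬝ᵥ r j') := by
    intro j j'
    split_ifs with h
    · subst h
      nlinarith [mul_le_mul_of_nonneg_right (ha j) (sq_nonneg (w j)),
        mul_nonneg he0 (sq_nonneg (w j))]
    · have h1 : |w j * w j' * (r j ⬝ᵥ r j')| ≤ |w j * w j'| * e := by
        rw [abs_mul]; exact mul_le_mul_of_nonneg_left (he j j' h) (abs_nonneg _)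
      have h2 : |w j * w j'| ≤ (w j ^ 2 + w j' ^ 2) / 2 := by
        rw [abs_le]
        constructor <;> nlinarith [sq_nonneg (w j + w j'), sq_nonneg (w j - w j')]
      have h3 := neg_abs_le (w j * w j' * (r j ⬝ᵥ r j'))
      have h4 := mul_le_mul_of_nonneg_right h2 he0
      linarith
  refine le_trans (le_of_eq ?_)
    (Finset.sum_le_sum fun j _ => Finset.sum_le_sum fun j' _ => h j j')
  simp only [Finset.sum_sub_distrib, Finset.sum_ite_eq, Finset.mem_univ, if_true,
    ← Finset.sum_div, ← Finset.mul_sum, Finset.sum_add_distrib, Finset.sum_const, Finset.card_univ,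
    nsmul_eq_mul]
  ring

/-- The singular values of the diagonal block of a cluster with centre `c` and deviations `r_j`. -/
theorem cluster_block_ge {J : Type*} [Fintype J] {d : ℕ} (c : Fin d → ℝ) (r : J → Fin d → ℝ)
    {β a e x η : ℝ} (hβ : 0 ≤ β) (ha : ∀ j, a ≤ r j ⬝ᵥ r j) (he0 : 0 ≤ e)
    (he : ∀ j j', j ≠ j' → |r j ⬝ᵥ r j'| ≤ e) (hae : 0 ≤ a - Fintype.card J * e)
    (hx : x ≤ c ⬝ᵥ c) (hη : ∀ j, -η ≤ c ⬝ᵥ r j) (v : J → ℝ) :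
    (Real.exp (β * (x - 2 * η)) * (β * (a - Fintype.card J * e))) ^ 2 * ∑ j, v j ^ 2
      ≤ ∑ j, (∑ j', Real.exp (β * (c + r j) ⬝ᵥ (c + r j')) * v j') ^ 2 := by
  apply sq_mul_sum_sq_le_of_quadratic_ge _ (by positivity)
  -- The terms `c ⬝ᵥ r j` only rescale the vector, each coordinate by at least `exp (-β η)`.
  set w : J → ℝ := fun j => Real.exp (β * c ⬝ᵥ r j) * v j with hw
  have h1 : ∑ j, ∑ j', v j * v j' * Real.exp (β * (c + r j) ⬝ᵥ (c + r j'))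
      = Real.exp (β * c ⬝ᵥ c) * ∑ j, ∑ j', w j * w j' * Real.exp (β * r j ⬝ᵥ r j') := by
    simp_rw [Finset.mul_sum]
    refine Finset.sum_congr rfl fun j _ => Finset.sum_congr rfl fun j' _ => ?_
    have : β * (c + r j) ⬝ᵥ (c + r j') = β * c ⬝ᵥ c + β * c ⬝ᵥ r j + β * c ⬝ᵥ r j'
        + β * r j ⬝ᵥ r j' := by
      simp only [add_dotProduct, dotProduct_add]
      rw [dotProduct_comm (r j) c]; ring
    rw [this, Real.exp_add, Real.exp_add, Real.exp_add]
    simp only [hw]; ring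
  have h2 : Real.exp (β * (-2 * η)) * ∑ j, v j ^ 2 ≤ ∑ j, w j ^ 2 := by
    rw [Finset.mul_sum]
    refine Finset.sum_le_sum fun j _ => ?_
    simp only [hw, mul_pow]
    gcongr
    rw [← Real.exp_nat_mul]
    apply Real.exp_le_exp.2
    have := mul_le_mul_of_nonneg_left (hη j) hβ
    push_cast; linarith
  rw [h1]
  calc Real.exp (β * (x - 2 * η)) * (β * (a - Fintype.card J * e)) * ∑ j, v j ^ 2
      = Real.exp (β * x) * (β * ((a - Fintype.card J * e) *
          (Real.exp (β * (-2 * η)) * ∑ j, v j ^ 2))) := by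
        rw [show β * (x - 2 * η) = β * x + β * (-2 * η) by ring, Real.exp_add]; ring
    _ ≤ Real.exp (β * c ⬝ᵥ c) * (β * ((a - Fintype.card J * e) * ∑ j, w j ^ 2)) := by
        gcongr
    _ ≤ Real.exp (β * c ⬝ᵥ c) * (β * ∑ j, ∑ j', w j * w j' * (r j ⬝ᵥ r j')) := by
        gcongr
        exact quadratic_gram_ge r w ha he0 he
    _ ≤ _ := by
        gcongr
        exact quadratic_exp_gram_ge r w hβ

/-- The Taylor polynomial of degree less than `N` of `exp`. -/
noncomputable def expTaylor (N : ℕ) (y : ℝ) : ℝ :=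
  ∑ l ∈ Finset.range N, y ^ l / (l.factorial : ℝ)

/-- For `l ≥ N` one has `|y|^l ≤ a^{-N} (a |y|)^l`. The free parameter `a` trades the decay in `N`
against the exponential moment needed. -/
theorem abs_exp_sub_expTaylor_le (N : ℕ) (y : ℝ) {a : ℝ} (ha : 1 ≤ a) :
    |Real.exp y - expTaylor N y| ≤ (a ^ N)⁻¹ * Real.exp (a * |y|) := by
  have ha0 : 0 < a := by linarith
  have h1 := (hasSum_nat_add_iff' N).2 (Real.hasSum_pow_div_factorial y)
  have h2 := ((hasSum_nat_add_iff' N).2 (Real.hasSum_pow_div_factorial (a * |y|))).mul_left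
    (a ^ N)⁻¹
  have h3 := h1.norm_le_of_bounded h2 fun l => by
    rw [norm_div, norm_pow, Real.norm_eq_abs, Real.norm_natCast, mul_pow, ← mul_div_assoc]
    gcongr
    rw [pow_add a]
    have : (a ^ N)⁻¹ * (a ^ l * a ^ N * |y| ^ (l + N)) = a ^ l * |y| ^ (l + N) := by
      field_simp
    rw [this]
    exact le_mul_of_one_le_left (by positivity) (one_le_pow₀ ha)
  refine h3.trans ?_
  gcongr
  rw [sub_le_self_iff]
  positivity

theorem sq_exp_sub_expTaylor_le (N : ℕ) (y : ℝ) {a : ℝ} (ha : 1 ≤ a) :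
    (Real.exp y - expTaylor N y) ^ 2
      ≤ (a ^ (2 * N))⁻¹ * (Real.exp (2 * a * y) + Real.exp (-(2 * a) * y)) := by
  have h := abs_exp_sub_expTaylor_le N y ha
  rw [← sq_abs]
  refine (pow_le_pow_left₀ (abs_nonneg _) h 2).trans ?_
  rw [mul_pow, ← Real.exp_nat_mul, inv_pow, ← pow_mul, mul_comm N 2]
  gcongr
  have e1 := Real.exp_pos (2 * a * y)
  have e2 := Real.exp_pos (-(2 * a) * y)
  rcases abs_cases y with ⟨hy, _⟩ | ⟨hy, _⟩ <;> rw [hy]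
  · rw [show ((2 : ℕ) : ℝ) * (a * y) = 2 * a * y by push_cast; ring]; linarith
  · rw [show ((2 : ℕ) : ℝ) * (a * -y) = -(2 * a) * y by push_cast; ring]; linarith

/-- Entrywise Taylor polynomials of Gram matrices have low rank. -/
theorem exists_expTaylor_factorization {ι : Type*} {d : ℕ} (z : ι → Fin d → ℝ) (β : ℝ) (N : ℕ) :
    ∃ U V : Matrix ι (Fin (∑ l : Fin N, d ^ (l : ℕ))) ℝ,
      (Matrix.of fun p q => expTaylor N (β * z p ⬝ᵥ z q)) = U * Vᵀ := by
  let T := Σ l : Fin N, (Fin l → Fin d)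
  have hT : Fintype.card T = ∑ l : Fin N, d ^ (l : ℕ) := by
    simp [T, Fintype.card_sigma]
  let e : Fin (∑ l : Fin N, d ^ (l : ℕ)) ≃ T := (Fintype.equivFinOfCardEq hT).symm
  refine ⟨Matrix.of fun p t => β ^ ((e t).1 : ℕ) / (((e t).1 : ℕ).factorial : ℝ) *
    ∏ i, z p ((e t).2 i), Matrix.of fun q t => ∏ i, z q ((e t).2 i), ?_⟩
  ext p q
  rw [Matrix.mul_apply]
  simp only [Matrix.of_apply, Matrix.transpose_apply]
  rw [e.sum_comp (fun t : T => β ^ (t.1 : ℕ) / ((t.1 : ℕ).factorial : ℝ) *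
    (∏ i, z p (t.2 i)) * ∏ i, z q (t.2 i)), Fintype.sum_sigma, expTaylor, Finset.sum_range]
  refine Finset.sum_congr rfl fun l _ => ?_
  rw [mul_pow, dotProduct_pow_eq, Finset.mul_sum, Finset.sum_div]
  exact Finset.sum_congr rfl fun f _ => by ring

section Events

variable {C b d : ℕ} {Δ : ℝ}

/-! ### The part outside of the diagonal blocks -/

/-- Markov's inequality for the squared norm. It is applied both to `exp` and to its Taylor
remainder. -/
theorem measure_norm_offBlock_ge_le {φ : ℝ → ℝ} (hφ : Measurable φ) {B E : ℝ}
    (hE : 0 < E) (hB : ∀ p q : Fin C × Fin b, p.1 ≠ q.1 →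
      ∫⁻ ω, ENNReal.ofReal (φ (inputRow ω p ⬝ᵥ inputRow ω q) ^ 2) ∂clusterMeasure C b d Δ
        ≤ ENNReal.ofReal B) :
    clusterMeasure C b d Δ {ω | E ≤
        ‖(Matrix.of fun p q => φ (inputRow ω p ⬝ᵥ inputRow ω q)).offBlock‖}
      ≤ ENNReal.ofReal (((C * b : ℕ) : ℝ) ^ 2 * B / E ^ 2) := by
  have h := measure_sum_ge_le (clusterMeasure C b d Δ)
    (Finset.univ : Finset ((Fin C × Fin b) × (Fin C × Fin b)))
    (fun x ω => if x.1.1 = x.2.1 then 0 else φ (inputRow ω x.1 ⬝ᵥ inputRow ω x.2) ^ 2)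
    (fun x => by split_ifs <;> fun_prop) (fun x ω => by split_ifs <;> positivity) (B := B)
    (fun x _ => by
      by_cases hx : x.1.1 = x.2.1
      · simp [hx]
      · simpa [hx] using hB x.1 x.2 hx) (pow_pos hE 2)
  have hcard : ((Finset.univ : Finset ((Fin C × Fin b) × (Fin C × Fin b))).card : ℝ)
      = ((C * b : ℕ) : ℝ) ^ 2 := by
    rw [Finset.card_univ]; simp; ring
  rw [hcard] at h
  refine (measure_mono fun ω hω => ?_).trans h
  have hω' : E ≤ ‖(Matrix.of fun p q => φ (inputRow ω p ⬝ᵥ inputRow ω q)).offBlock‖ := hω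
  have h2 := pow_le_pow_left₀ hE.le hω' 2
  rw [Matrix.frobenius_norm_sq, ← Fintype.sum_prod_type'] at h2
  refine h2.trans (le_of_eq (Finset.sum_congr rfl fun x _ => ?_))
  simp [Matrix.offBlock, ite_pow]

theorem measure_norm_offBlock_attentionMatrix_ge_le {β E : ℝ} (hd : 0 < d) (hΔ0 : 0 ≤ Δ)
    (hΔ1 : Δ ≤ 1) (hβ : (8 * β / d) ^ 2 ≤ 1 / 2) (hE : 0 < E) :
    clusterMeasure C b d Δ {ω | E ≤ ‖(attentionMatrix β ω).offBlock‖}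
      ≤ ENNReal.ofReal (((C * b : ℕ) : ℝ) ^ 2 * Real.exp (64 * β ^ 2 / d) / E ^ 2) := by
  refine measure_norm_offBlock_ge_le (φ := fun y => Real.exp (β * y)) (by fun_prop)
    hE fun p q hpq => ?_
  have h := lintegral_exp_inputRow_dotProduct_le (t := 2 * β) hd hΔ0 hΔ1
    (by rw [show 4 * (2 * β) = 8 * β by ring]; exact hβ) hpq
  rw [show 16 * (2 * β) ^ 2 = 64 * β ^ 2 by ring] at h
  convert h using 4 with ω
  rw [← Real.exp_nat_mul]; push_cast; ring_nf

/-! ### Approximation by flat block butterfly + low-rank matrices -/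

/-- A stride 2 factor may have arbitrary diagonal blocks, so it absorbs those of `M - T` together
with the correction `-1` for the identity. -/
theorem exists_flatBlockButterflyAddLowRank (hC : Even C) {r : ℕ}
    (M T : Matrix (Fin C × Fin b) (Fin C × Fin b) ℝ) {U V : Matrix (Fin C × Fin b) (Fin r) ℝ}
    (hT : T = U * Vᵀ) :
    ∃ R, IsFlatBlockButterflyAddLowRank C b 1 r R ∧ M - R = (M - T).offBlock := by
  refine ⟨(M - T - (M - T).offBlock) + U * Vᵀ, ⟨_, U, V, ⟨le_rfl, 1,
    fun _ => M - T - (M - T).offBlock - 1, ?_, ?_⟩, rfl⟩, ?_⟩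
  · intro i hi
    obtain rfl : i = 1 := by simpa using hi
    refine ⟨by simpa using hC.two_dvd, fun I J p q h => ?_⟩
    have hIJ : I ≠ J := by
      rintro rfl
      exact h ⟨rfl, rfl⟩
    simp [Matrix.offBlock, hIJ]
  · simp
  · rw [← hT]; abel

theorem measure_not_exists_butterfly_le {β a ε : ℝ} (N : ℕ) (hd : 0 < d) (hΔ0 : 0 ≤ Δ)
    (hΔ1 : Δ ≤ 1) (ha : 1 ≤ a) (hβ : (8 * (a * β) / d) ^ 2 ≤ 1 / 2) (hε : 0 < ε) (hC : Even C)
    (hn : 0 < C * b) :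
    clusterMeasure C b d Δ {ω | ¬ ∃ R : Matrix (Fin C × Fin b) (Fin C × Fin b) ℝ,
        IsFlatBlockButterflyAddLowRank C b 1 (∑ l : Fin N, d ^ (l : ℕ)) R ∧
        ‖attentionMatrix β ω - R‖ ≤ ε * ((C * b : ℕ) : ℝ)}
      ≤ ENNReal.ofReal (2 * (a ^ (2 * N))⁻¹ * Real.exp (64 * (a * β) ^ 2 / d) / ε ^ 2) := by
  have hn' : (0 : ℝ) < ((C * b : ℕ) : ℝ) := by exact_mod_cast hn
  have hB : ∀ p q : Fin C × Fin b, p.1 ≠ q.1 →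
      ∫⁻ ω, ENNReal.ofReal ((fun y => Real.exp (β * y) - expTaylor N (β * y))
        (inputRow ω p ⬝ᵥ inputRow ω q) ^ 2) ∂clusterMeasure C b d Δ
        ≤ ENNReal.ofReal (2 * (a ^ (2 * N))⁻¹ * Real.exp (64 * (a * β) ^ 2 / d)) := by
    intro p q hpq
    have h1 := lintegral_exp_inputRow_dotProduct_le (t := 2 * (a * β)) hd hΔ0 hΔ1
      (by rw [show 4 * (2 * (a * β)) = 8 * (a * β) by ring]; exact hβ) hpq
    have h2 := lintegral_exp_inputRow_dotProduct_le (t := -(2 * (a * β))) hd hΔ0 hΔ1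
      (by rw [show 4 * (-(2 * (a * β))) = -(8 * (a * β)) by ring, neg_div, neg_sq]; exact hβ) hpq
    rw [show 16 * (2 * (a * β)) ^ 2 = 64 * (a * β) ^ 2 by ring] at h1
    rw [show 16 * (-(2 * (a * β))) ^ 2 = 64 * (a * β) ^ 2 by ring] at h2
    calc ∫⁻ ω, ENNReal.ofReal ((fun y => Real.exp (β * y) - expTaylor N (β * y))
        (inputRow ω p ⬝ᵥ inputRow ω q) ^ 2) ∂clusterMeasure C b d Δ
        ≤ ∫⁻ ω, ENNReal.ofReal (a ^ (2 * N))⁻¹ *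
          (ENNReal.ofReal (Real.exp (2 * (a * β) * inputRow ω p ⬝ᵥ inputRow ω q)) +
          ENNReal.ofReal (Real.exp (-(2 * (a * β)) * inputRow ω p ⬝ᵥ inputRow ω q)))
          ∂clusterMeasure C b d Δ := by
          refine lintegral_mono fun ω => ?_
          rw [← ENNReal.ofReal_add (by positivity) (by positivity),
            ← ENNReal.ofReal_mul (by positivity)]
          refine ENNReal.ofReal_le_ofReal ?_
          have h := sq_exp_sub_expTaylor_le N (β * (inputRow ω p ⬝ᵥ inputRow ω q)) ha
          rw [show 2 * a * (β * (inputRow ω p ⬝ᵥ inputRow ω q))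
              = 2 * (a * β) * (inputRow ω p ⬝ᵥ inputRow ω q) by ring,
            show -(2 * a) * (β * (inputRow ω p ⬝ᵥ inputRow ω q))
              = -(2 * (a * β)) * (inputRow ω p ⬝ᵥ inputRow ω q) by ring] at h
          exact h
      _ ≤ ENNReal.ofReal (a ^ (2 * N))⁻¹ * (ENNReal.ofReal (Real.exp (64 * (a * β) ^ 2 / d)) +
          ENNReal.ofReal (Real.exp (64 * (a * β) ^ 2 / d))) := by
          rw [lintegral_const_mul _ (by fun_prop), lintegral_add_left (by fun_prop)]
          gcongr
      _ = _ := by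
          rw [← ENNReal.ofReal_add (by positivity) (by positivity),
            ← ENNReal.ofReal_mul (by positivity)]
          congr 1; ring
  have hφ : Measurable fun y : ℝ => Real.exp (β * y) - expTaylor N (β * y) := by
    unfold expTaylor; fun_prop
  refine (measure_mono fun ω hω => ?_).trans ((measure_norm_offBlock_ge_le hφ
    (mul_pos hε hn') hB).trans (le_of_eq ?_))
  · obtain ⟨U, V, hT⟩ := exists_expTaylor_factorization (inputRow ω) β N
    obtain ⟨R, hR, hMR⟩ := exists_flatBlockButterflyAddLowRank hC (attentionMatrix β ω) _ hT
    by_contra hlt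
    refine hω ⟨R, hR, ?_⟩
    rw [hMR]
    exact (not_le.1 hlt).le
  · congr 1
    field_simp

/-! ### Lower bounds for low-rank approximations -/

open Classical in
-- `A i` is the event that cluster `i` is bad. Markov's inequality allows fewer than `k'` bad
-- clusters, so a union bound over clusters is avoided. `J` selects the inputs used in each cluster.
theorem measure_not_low_rank_le {β E k k' p σ : ℝ} (hd : 0 < d) (hΔ0 : 0 ≤ Δ) (hΔ1 : Δ ≤ 1)
    (hβ : (8 * β / d) ^ 2 ≤ 1 / 2) (hE : 0 < E) (hk : 0 ≤ k) (hk' : 0 < k')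
    {J : Type*} [Fintype J] {g : J → Fin b} (hg : g.Injective)
    (A : Fin C → Set (ClusterSample C b d)) (hA : ∀ i, MeasurableSet (A i))
    (hp : ∀ i, clusterMeasure C b d Δ (A i) ≤ ENNReal.ofReal p) (hp0 : 0 ≤ p)
    (hblock : ∀ ω i, ω ∉ A i → ∀ v : J → ℝ, σ ^ 2 * ∑ j, v j ^ 2
      ≤ ∑ j, (∑ j', attentionMatrix β ω (i, g j) (i, g j') * v j') ^ 2) :
    clusterMeasure C b d Δ {ω | ¬ ∀ R : Matrix (Fin C × Fin b) (Fin C × Fin b) ℝ,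
        k + R.rank ≤ ((C : ℝ) - k') * Fintype.card J →
        σ * √k - E ≤ ‖attentionMatrix β ω - R‖}
      ≤ ENNReal.ofReal (C * p / k'
        + ((C * b : ℕ) : ℝ) ^ 2 * Real.exp (64 * β ^ 2 / d) / E ^ 2) := by
  have h1 := measure_card_ge_le (clusterMeasure C b d Δ) A hA hp hk'
  rw [Fintype.card_fin] at h1
  have h2 := measure_norm_offBlock_attentionMatrix_ge_le (C := C) (b := b) hd hΔ0 hΔ1 hβ hE
  rw [ENNReal.ofReal_add (by positivity) (by positivity)]
  refine le_trans (measure_mono fun ω hω => ?_) ((measure_union_le _ _).trans (add_le_add h1 h2))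
  by_contra hlt
  simp only [Set.mem_union, not_or] at hlt
  have hlt1 : ((Finset.univ.filter fun i => ω ∈ A i).card : ℝ) < k' := not_le.1 hlt.1
  have hlt2 : ‖(attentionMatrix β ω).offBlock‖ ≤ E := (not_le.1 hlt.2).le
  refine hω fun R hR => ?_
  refine Matrix.frobenius_norm_sub_ge_of_blocks _ R (Finset.univ.filter fun i => ω ∉ A i) hg hk
    (fun i hi => hblock ω i (Finset.mem_filter.1 hi).2) hlt2 (hR.trans ?_)
  have hcard := Finset.card_filter_add_card_filter_not (s := (Finset.univ : Finset (Fin C)))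
    (fun i => ω ∈ A i)
  rw [Finset.card_univ, Fintype.card_fin] at hcard
  have hcard' : ((Finset.univ.filter fun i => ω ∈ A i).card : ℝ)
    + ((Finset.univ.filter fun i => ω ∉ A i).card : ℝ) = C := by exact_mod_cast hcard
  gcongr
  linarith

/-! ### Concentration of norms and scalar products within one cluster. -/

variable {ε : ℝ}

theorem measure_centre_normSq_le (hd : 0 < d) (hε : 0 ≤ ε) (i : Fin C) :
    clusterMeasure C b d Δ {ω | ω.1 i ⬝ᵥ ω.1 i ≤ 1 - ε}
      ≤ ENNReal.ofReal (Real.exp (-(d * ε ^ 2 / 4))) := by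
  have hd' : (0 : ℝ) < d := by exact_mod_cast hd
  have h := measure_normSq_le_le (d := d) (σ := 1 / √(d : ℝ)) (by positivity) hε
  rw [one_div_sqrt_sq, mul_one_div_cancel hd'.ne', mul_one] at h
  rw [← (measurePreserving_centre (b := b) (Δ := Δ) i).measure_preimage
    (measurableSet_le (by fun_prop) (by fun_prop)).nullMeasurableSet] at h
  exact h

theorem measure_deviation_normSq_le (hd : 0 < d) (hΔ : 0 < Δ) (hε : 0 ≤ ε) (i : Fin C)
    (j : Fin b) :
    clusterMeasure C b d Δ {ω | ω.2 i j ⬝ᵥ ω.2 i j ≤ (1 - ε) * Δ ^ 2}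
      ≤ ENNReal.ofReal (Real.exp (-(d * ε ^ 2 / 4))) := by
  have hd' : (0 : ℝ) < d := by exact_mod_cast hd
  have h := measure_normSq_le_le (d := d) (σ := Δ / √(d : ℝ)) (by positivity) hε
  rw [div_sqrt_sq, mul_div_cancel₀ _ hd'.ne'] at h
  rw [← (measurePreserving_deviation (Δ := Δ) i j).measure_preimage
    (measurableSet_le (by fun_prop) (by fun_prop)).nullMeasurableSet] at h
  exact h

theorem measure_centre_deviation_le (hd : 0 < d) (hΔ0 : 0 ≤ Δ) (hΔ1 : Δ ≤ 1) (hε0 : 0 < ε)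
    (hε1 : ε ≤ 1) (i : Fin C) (j : Fin b) :
    clusterMeasure C b d Δ {ω | ω.1 i ⬝ᵥ ω.2 i j ≤ -ε}
      ≤ ENNReal.ofReal (Real.exp (-(d * ε ^ 2 / 4))) := by
  have hd' : (0 : ℝ) < d := by exact_mod_cast hd
  have hΔ2 : Δ ^ 2 ≤ 1 := pow_le_one₀ hΔ0 hΔ1
  have h := measure_dotProduct_ge_le hd (σ := 1 / √(d : ℝ)) (τ := Δ / √(d : ℝ)) (ρ := 1)
    (ε := -ε) one_pos (by
      rw [one_div_sqrt_sq, div_sqrt_sq, div_mul_div_comm, one_mul, div_pow, one_pow, ← sq]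
      gcongr) (by rw [neg_sq]; exact pow_le_one₀ hε0.le hε1)
  rw [← (measurePreserving_centre_deviation (Δ := Δ) i i j).measure_preimage
    (measurableSet_le (by fun_prop) (by fun_prop)).nullMeasurableSet, neg_sq] at h
  refine (measure_mono fun ω hω => ?_).trans h
  have hω' : ω.1 i ⬝ᵥ ω.2 i j ≤ -ε := hω
  change ε ^ 2 / 2 * d ≤ -ε * d / (2 * 1) * (ω.1 i ⬝ᵥ ω.2 i j)
  nlinarith [mul_le_mul_of_nonneg_left hω' (mul_pos hε0 hd').le]

theorem measure_abs_deviation_deviation_ge (hd : 0 < d) (hΔ : 0 < Δ) (hε0 : 0 < ε)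
    (hε1 : ε ≤ 1) (i : Fin C) {j j' : Fin b} (hj : j ≠ j') :
    clusterMeasure C b d Δ {ω | ε * Δ ^ 2 ≤ |ω.2 i j ⬝ᵥ ω.2 i j'|}
      ≤ ENNReal.ofReal (2 * Real.exp (-(d * ε ^ 2 / 4))) := by
  have hd' : (0 : ℝ) < d := by exact_mod_cast hd
  have hΔ2 : 0 < Δ ^ 2 := by positivity
  have key : ∀ e : ℝ, e ^ 2 = ε ^ 2 → clusterMeasure C b d Δ
      {ω | e ^ 2 / 2 * d ≤ e * d / (2 * Δ ^ 2) * ω.2 i j ⬝ᵥ ω.2 i j'}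
      ≤ ENNReal.ofReal (Real.exp (-(d * ε ^ 2 / 4))) := by
    intro e he
    have h := measure_dotProduct_ge_le hd (σ := Δ / √(d : ℝ)) (τ := Δ / √(d : ℝ)) (ρ := Δ ^ 2)
      (ε := e) hΔ2 (by rw [div_sqrt_sq, ← sq]) (by rw [he]; exact pow_le_one₀ hε0.le hε1)
    rw [← (measurePreserving_deviation_deviation (Δ := Δ) (i := i) (i' := i)
      (Or.inr hj)).measure_preimage
      (measurableSet_le (by fun_prop) (by fun_prop)).nullMeasurableSet, he] at h
    rw [he]
    exact h
  rw [two_mul, ENNReal.ofReal_add (Real.exp_pos _).le (Real.exp_pos _).le]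
  refine le_trans (measure_mono fun ω hω => ?_) ((measure_union_le _ _).trans
    (add_le_add (key ε rfl) (key (-ε) (neg_sq ε))))
  have hω' : ε * Δ ^ 2 ≤ |ω.2 i j ⬝ᵥ ω.2 i j'| := hω
  rw [le_abs] at hω'
  have main : ∀ x : ℝ, ε * Δ ^ 2 ≤ x → ε ^ 2 / 2 * d ≤ ε * d / (2 * Δ ^ 2) * x := by
    intro x hx
    calc ε ^ 2 / 2 * d = ε * d / (2 * Δ ^ 2) * (ε * Δ ^ 2) := by field_simp
      _ ≤ _ := by gcongr
  rcases hω' with h | h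
  · exact Or.inl (main _ h)
  · refine Or.inr ?_
    have := main _ h
    change (-ε) ^ 2 / 2 * d ≤ -ε * d / (2 * Δ ^ 2) * (ω.2 i j ⬝ᵥ ω.2 i j')
    rw [neg_sq]
    refine this.trans (le_of_eq ?_)
    ring

/-! ### Signs of the scalar products -/

/-- Changes the sign of the inputs of cluster `i`. -/
def flipCluster (i : Fin C) (ω : ClusterSample C b d) : ClusterSample C b d :=
  (fun k => if k = i then -ω.1 k else ω.1 k, fun k j => if k = i then -ω.2 k j else ω.2 k j)

theorem measurePreserving_neg_isoGaussian (σ : ℝ) :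
    MeasurePreserving (fun x : Fin d → ℝ => -x) (isoGaussian d σ) (isoGaussian d σ) := by
  rw [isoGaussian_eq_pi]
  refine measurePreserving_pi (f := fun _ x => -x) _ _ fun _ => ⟨measurable_neg, ?_⟩
  have := gaussianReal_map_neg (μ := 0) (v := (σ ^ 2).toNNReal)
  rwa [neg_zero] at this

theorem measurePreserving_flipCluster (i : Fin C) :
    MeasurePreserving (flipCluster i : ClusterSample C b d → ClusterSample C b d)
      (clusterMeasure C b d Δ) (clusterMeasure C b d Δ) := by
  suffices h : MeasurePreserving (Prod.map
      (fun (x : Fin C → Fin d → ℝ) k => if k = i then -x k else x k)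
      (fun (x : Fin C → Fin b → Fin d → ℝ) k j => if k = i then -x k j else x k j))
      (clusterMeasure C b d Δ) (clusterMeasure C b d Δ) from h
  refine MeasurePreserving.prod ?_ ?_
  · refine measurePreserving_pi (f := fun k x => if k = i then -x else x) _ _ fun k => ?_
    by_cases h : k = i
    · simpa [h] using measurePreserving_neg_isoGaussian _
    · simp only [if_neg h]
      exact MeasurePreserving.id _
  · refine measurePreserving_pi
      (f := fun k (x : Fin b → Fin d → ℝ) j => if k = i then -x j else x j) _ _ fun k => ?_
    refine measurePreserving_pi (f := fun _ x => if k = i then -x else x) _ _ fun j => ?_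
    by_cases h : k = i
    · simpa [h] using measurePreserving_neg_isoGaussian _
    · simp only [if_neg h]
      exact MeasurePreserving.id _

theorem inputRow_flipCluster (i : Fin C) (ω : ClusterSample C b d) (p : Fin C × Fin b) :
    inputRow (flipCluster i ω) p = if p.1 = i then -inputRow ω p else inputRow ω p := by
  unfold inputRow flipCluster
  by_cases h : p.1 = i
  · simp [h, add_comm]
  · simp [h]

theorem Real.measurable_sign : Measurable Real.sign := by
  unfold Real.sign
  exact Measurable.ite measurableSet_Iio measurable_const
    (Measurable.ite measurableSet_Ioi measurable_const measurable_const)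

theorem Real.abs_sign_le_one (x : ℝ) : |Real.sign x| ≤ 1 := by
  rcases Real.sign_apply_eq x with h | h | h <;> simp [h]

/-- The sign of the scalar product of the `j`-th inputs of two clusters. -/
noncomputable def clusterSign (j : Fin b) (e : Fin C × Fin C) (ω : ClusterSample C b d) : ℝ :=
  Real.sign (inputRow ω (e.1, j) ⬝ᵥ inputRow ω (e.2, j))

theorem measurable_clusterSign (j : Fin b) (e : Fin C × Fin C) :
    Measurable (clusterSign j e : ClusterSample C b d → ℝ) :=
  Real.measurable_sign.comp (by fun_prop)

theorem clusterSign_flipCluster_of_ne (j : Fin b) {e : Fin C × Fin C} {i : Fin C} (h1 : e.1 ≠ i)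
    (h2 : e.2 ≠ i) (ω : ClusterSample C b d) :
    clusterSign j e (flipCluster i ω) = clusterSign j e ω := by
  simp [clusterSign, inputRow_flipCluster, h1, h2]

theorem clusterSign_flipCluster_fst (j : Fin b) {e : Fin C × Fin C} (h : e.2 ≠ e.1)
    (ω : ClusterSample C b d) :
    clusterSign j e (flipCluster e.1 ω) = -clusterSign j e ω := by
  simp [clusterSign, inputRow_flipCluster, h, Real.sign_neg]

theorem clusterSign_flipCluster_snd (j : Fin b) {e : Fin C × Fin C} (h : e.1 ≠ e.2)
    (ω : ClusterSample C b d) :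
    clusterSign j e (flipCluster e.2 ω) = -clusterSign j e ω := by
  simp [clusterSign, inputRow_flipCluster, h, Real.sign_neg]

/-- Distinct ordered pairs share at most one index, so some index of `e` is not in `f`. Flipping
that cluster preserves the law and negates the product. -/
theorem integral_clusterSign_mul_eq_zero (j : Fin b) {e f : Fin C × Fin C} (he : e.1 < e.2)
    (hf : f.1 < f.2) (hef : e ≠ f) :
    ∫ ω, clusterSign j e ω * clusterSign j f ω ∂clusterMeasure C b d Δ = 0 := by
  have key : ∀ i : Fin C, (∀ ω : ClusterSample C b d,
      clusterSign j e (flipCluster i ω) = -clusterSign j e ω) → f.1 ≠ i → f.2 ≠ i →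
      ∫ ω, clusterSign j e ω * clusterSign j f ω ∂clusterMeasure C b d Δ = 0 := by
    intro i h1 h2 h3
    have hm := integral_map (μ := clusterMeasure C b d Δ) (measurePreserving_flipCluster (b := b) (d := d) (Δ := Δ)
      i).measurable.aemeasurable (f := fun ω => clusterSign j e ω * clusterSign j f ω)
      ((measurable_clusterSign j e).mul (measurable_clusterSign j f)).aestronglyMeasurable
    rw [(measurePreserving_flipCluster i).map_eq] at hm
    simp_rw [h1, clusterSign_flipCluster_of_ne j h2 h3, neg_mul, integral_neg] at hm
    linarith
  by_cases h : f.1 ≠ e.1 ∧ f.2 ≠ e.1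
  · exact key e.1 (clusterSign_flipCluster_fst j he.ne') h.1 h.2
  · refine key e.2 (clusterSign_flipCluster_snd j he.ne) ?_ ?_
    · intro h'
      apply h
      constructor
      · exact fun h2 => he.ne (h2.symm.trans h')
      · exact fun h2 => absurd (he.trans (h' ▸ hf)) (by rw [h2]; exact lt_irrefl _)
    · intro h'
      apply h
      constructor
      · exact fun h2 => hef (Prod.ext h2.symm h'.symm)
      · exact fun h2 => he.ne (h2.symm.trans h')

/-- Chebyshev: without cross terms the second moment of the sum is at most `P.card`. -/
theorem measure_sum_le_neg_half_card_le {α ι : Type*} [MeasurableSpace α] (μ : Measure α)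
    [IsProbabilityMeasure μ] (P : Finset ι) (hP : P.Nonempty) (f : ι → α → ℝ)
    (hf : ∀ i, Measurable (f i)) (hf1 : ∀ i x, |f i x| ≤ 1)
    (h : ∀ i ∈ P, ∀ j ∈ P, i ≠ j → ∫ x, f i x * f j x ∂μ = 0) :
    μ {x | ∑ i ∈ P, f i x ≤ -(P.card / 2 : ℝ)} ≤ ENNReal.ofReal (4 / P.card) := by
  have hN : (0 : ℝ) < P.card := by exact_mod_cast hP.card_pos
  have hint : ∀ i j, Integrable (fun x => f i x * f j x) μ := fun i j =>
    Integrable.of_bound ((hf i).mul (hf j)).aestronglyMeasurable 1 (ae_of_all _ fun x => by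
      rw [norm_mul]
      exact mul_le_one₀ (hf1 i x) (norm_nonneg _) (hf1 j x))
  have hsq : ∀ x, (∑ i ∈ P, f i x) ^ 2 = ∑ i ∈ P, ∑ j ∈ P, f i x * f j x := fun x => by
    rw [sq, Finset.sum_mul_sum]
  have h2 : ∫ x, (∑ i ∈ P, f i x) ^ 2 ∂μ ≤ P.card := by
    simp_rw [hsq]
    rw [integral_finsetSum _ fun i _ => integrable_finsetSum _ fun j _ => hint i j]
    calc ∑ i ∈ P, ∫ x, ∑ j ∈ P, f i x * f j x ∂μ ≤ ∑ i ∈ P, (1 : ℝ) := by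
          refine Finset.sum_le_sum fun i hi => ?_
          rw [integral_finsetSum _ fun j _ => hint i j, Finset.sum_eq_single_of_mem i hi
            fun j hj hji => h i hi j hj hji.symm]
          calc ∫ x, f i x * f i x ∂μ ≤ ∫ _, (1 : ℝ) ∂μ := by
                refine integral_mono (hint i i) (integrable_const _) fun x => ?_
                have := hf1 i x
                rw [← sq, ← sq_abs]
                exact pow_le_one₀ (abs_nonneg _) this
            _ = 1 := by simp
      _ = P.card := by simp
  have h3 := mul_meas_ge_le_integral_of_nonneg (μ := μ) (f := fun x => (∑ i ∈ P, f i x) ^ 2)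
    (ae_of_all _ fun x => sq_nonneg _) (by
      simp_rw [hsq]
      exact integrable_finsetSum _ fun i _ => integrable_finsetSum _ fun j _ => hint i j)
    ((P.card / 2 : ℝ) ^ 2)
  have h4 : μ.real {x | ∑ i ∈ P, f i x ≤ -(P.card / 2 : ℝ)} ≤ 4 / P.card := by
    have h5 : μ.real {x | ∑ i ∈ P, f i x ≤ -(P.card / 2 : ℝ)}
        ≤ μ.real {x | (P.card / 2 : ℝ) ^ 2 ≤ (∑ i ∈ P, f i x) ^ 2} := by
      refine measureReal_mono fun x hx => ?_
      have hx' : ∑ i ∈ P, f i x ≤ -(P.card / 2 : ℝ) := hx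
      change (P.card / 2 : ℝ) ^ 2 ≤ (∑ i ∈ P, f i x) ^ 2
      nlinarith
    have h6 := h3.trans h2
    refine h5.trans ?_
    rw [le_div_iff₀ hN]
    nlinarith
  rw [← ofReal_measureReal]
  exact ENNReal.ofReal_le_ofReal h4

/-! ### Lower bounds for sparse approximations -/

/-- Each position of `T` where `R` vanishes contributes at least `1`. -/
theorem frobenius_norm_sub_sq_ge_of_sparse {ι : Type*} [Fintype ι] (M R : Matrix ι ι ℝ)
    (T : Finset (ι × ι)) (hT : ∀ x ∈ T, 1 ≤ M x.1 x.2) :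
    (T.card : ℝ) - numNonzeros R ≤ ‖M - R‖ ^ 2 := by
  classical
  have hnz : numNonzeros R = (Finset.univ.filter fun x : ι × ι => R x.1 x.2 ≠ 0).card := by
    unfold numNonzeros
    rw [← Set.ncard_coe_finset]
    congr; ext; simp
  have h1 := Finset.card_le_card_sdiff_add_card (s := T)
    (t := Finset.univ.filter fun x : ι × ι => R x.1 x.2 ≠ 0)
  rw [← hnz] at h1
  have h1' : (T.card : ℝ) ≤
      (T \ Finset.univ.filter fun x : ι × ι => R x.1 x.2 ≠ 0).card + numNonzeros R := by
    exact_mod_cast h1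
  rw [Matrix.frobenius_norm_sq, ← Fintype.sum_prod_type']
  calc (T.card : ℝ) - numNonzeros R
      ≤ ∑ _x ∈ T \ Finset.univ.filter fun x : ι × ι => R x.1 x.2 ≠ 0, (1 : ℝ) := by
        rw [Finset.sum_const, nsmul_eq_mul, mul_one]; linarith
    _ ≤ ∑ x ∈ T \ Finset.univ.filter fun x : ι × ι => R x.1 x.2 ≠ 0, (M - R) x.1 x.2 ^ 2 := by
        refine Finset.sum_le_sum fun x hx => ?_
        rw [Finset.mem_sdiff, Finset.mem_filter] at hx
        have hR : R x.1 x.2 = 0 := by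
          by_contra h; exact hx.2 ⟨Finset.mem_univ _, h⟩
        rw [Matrix.sub_apply, hR, sub_zero]
        exact one_le_pow₀ (hT x hx.1)
    _ ≤ _ := Finset.sum_le_sum_of_subset_of_nonneg (Finset.subset_univ _)
        fun _ _ _ => sq_nonneg _

theorem four_mul_card_filter_nonneg_ge {ι : Type*} (P : Finset ι) (x : ι → ℝ)
    (h : -(P.card / 2 : ℝ) ≤ ∑ i ∈ P, Real.sign (x i)) :
    (P.card : ℝ) ≤ 4 * (P.filter fun i => 0 ≤ x i).card := by
  -- Zero counts as nonnegative, so ties need no separate treatment.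
  have h1 : ∑ i ∈ P, Real.sign (x i) ≤ ∑ i ∈ P, (2 * (if 0 ≤ x i then 1 else 0) - 1 : ℝ) := by
    refine Finset.sum_le_sum fun i _ => ?_
    split_ifs with hi
    · have := (abs_le.1 (Real.abs_sign_le_one (x i))).2
      linarith
    · rw [Real.sign_of_neg (not_le.1 hi)]; norm_num
  rw [Finset.sum_sub_distrib, ← Finset.mul_sum, Finset.sum_boole, Finset.sum_const, nsmul_eq_mul,
    mul_one] at h1
  linarith

theorem measure_not_sparse_le {β s : ℝ} (hβ : 0 ≤ β) (hC : 2 ≤ C) (hb : 0 < b) :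
    clusterMeasure C b d Δ {ω | ¬ ∀ R : Matrix (Fin C × Fin b) (Fin C × Fin b) ℝ,
        (numNonzeros R : ℝ) ≤ s → (C : ℝ) ^ 2 / 16 - s ≤ ‖attentionMatrix β ω - R‖ ^ 2}
      ≤ ENNReal.ofReal (16 / (C : ℝ) ^ 2) := by
  let P : Finset (Fin C × Fin C) := Finset.univ.filter fun e => e.1 < e.2
  -- One input per cluster suffices: it gives at least `C² / 4` pairs, a quarter of which will have
  -- entries at least `1`.
  let j : Fin b := ⟨0, hb⟩
  have hC' : (2 : ℝ) ≤ C := by exact_mod_cast hC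
  have hPcard : (C : ℝ) ^ 2 / 4 ≤ P.card := by
    have h1 : P.card = C.choose 2 := by
      simpa [P] using Fintype.card_product_filter_lt (α := Fin C)
    rw [h1, Nat.cast_choose_two]
    nlinarith
  have hP : P.Nonempty := by
    rw [← Finset.card_pos]
    have : (0 : ℝ) < P.card := by nlinarith
    exact_mod_cast this
  have hm := measure_sum_le_neg_half_card_le (clusterMeasure C b d Δ) P hP (clusterSign j)
    (measurable_clusterSign j) (fun e ω => Real.abs_sign_le_one _) fun e he f hf hef =>
      integral_clusterSign_mul_eq_zero j (Finset.mem_filter.1 he).2 (Finset.mem_filter.1 hf).2 hef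
  refine (measure_mono fun ω hω => ?_).trans (hm.trans (ENNReal.ofReal_le_ofReal ?_))
  · by_contra hlt
    refine hω fun R hR => ?_
    have h1 := four_mul_card_filter_nonneg_ge P
      (fun e => inputRow ω (e.1, j) ⬝ᵥ inputRow ω (e.2, j)) (not_le.1 hlt).le
    set S := P.filter fun e => 0 ≤ inputRow ω (e.1, j) ⬝ᵥ inputRow ω (e.2, j) with hS
    have h2 := frobenius_norm_sub_sq_ge_of_sparse (attentionMatrix β ω) R
      (S.map ⟨fun e => ((e.1, j), (e.2, j)), fun e f h => by
        simp only [Prod.mk.injEq, and_true] at h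
        exact Prod.ext h.1 h.2⟩) (by
        intro x hx
        obtain ⟨e, he, rfl⟩ := Finset.mem_map.1 hx
        exact Real.one_le_exp (mul_nonneg hβ (Finset.mem_filter.1 he).2))
    rw [Finset.card_map] at h2
    linarith
  · rw [div_le_div_iff₀ (by nlinarith) (by positivity)]
    linarith

end Events

/-! ### The parameter regime -/

/-- `√(log n)`, the natural scale of the parameters. -/
noncomputable def sqrtLog (n : ℕ) : ℝ := √(Real.log n)

theorem tendsto_sqrtLog : Tendsto sqrtLog atTop atTop :=
  Real.tendsto_sqrt_atTop.comp (Real.tendsto_log_atTop.comp tendsto_natCast_atTop_atTop)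

theorem sqrtLog_sq (n : ℕ) : sqrtLog n ^ 2 = Real.log n :=
  Real.sq_sqrt (Real.log_natCast_nonneg n)

theorem exp_sqrtLog_sq {n : ℕ} (hn : 0 < n) : Real.exp (sqrtLog n ^ 2) = n := by
  rw [sqrtLog_sq, Real.exp_log (by exact_mod_cast hn)]

/-- The consequences of the parameter regime for large `n`, with `s = √(log n)`. -/
structure RegimeBounds (γ κ K L : ℝ) (C b d : ℕ) (Δ β s : ℝ) : Prop where
  C_pos : 0 < C
  b_pos : 0 < b
  b_le : (b : ℝ) ≤ 1 / γ
  le_C : γ * ((C * b : ℕ) : ℝ) ≤ C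
  C_le : (C : ℝ) ≤ ((C * b : ℕ) : ℝ)
  n_eq : ((C * b : ℕ) : ℝ) = Real.exp (s ^ 2)
  d_pos : 0 < d
  dim : κ * s ^ 3 ≤ d
  dist_nonneg : 0 ≤ Δ
  dist_le_one : Δ ≤ 1
  dist_sq_le : Δ ^ 2 ≤ K ^ 2 / s
  temp_ge : (1 - Δ ^ 2) * s ^ 2 ≤ β
  temp_nonneg : 0 ≤ β
  temp_le : β ≤ L * s ^ 2

theorem ClusterRegime.bounds {γ κ K L : ℝ} (hγ : 0 < γ) (hκ : 0 < κ) {C b d n : ℕ} {Δ β : ℝ}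
    (h : ClusterRegime γ κ K L C b d Δ β) (hn : C * b = n) (hn0 : 0 < n) (hs : 0 < sqrtLog n)
    (hs' : K ^ 2 ≤ sqrtLog n) : RegimeBounds γ κ K L C b d Δ β (sqrtLog n) := by
  subst hn
  set s := sqrtLog (C * b) with hs_def
  obtain ⟨h1, h2, h3, h4, h5, h6⟩ := h
  have hlog : Real.log ((C * b : ℕ) : ℝ) = s ^ 2 := (sqrtLog_sq _).symm
  rw [hlog] at h2 h4 h5 h6
  have hC : 0 < C := Nat.pos_of_mul_pos_right hn0
  have hb : 0 < b := Nat.pos_of_mul_pos_left hn0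
  have hC' : (0 : ℝ) < C := by exact_mod_cast hC
  have hb' : (1 : ℝ) ≤ b := by exact_mod_cast hb
  have e1 : (s ^ 2) ^ (3 / 2 : ℝ) = s ^ 3 := by
    rw [← Real.rpow_natCast s 2, ← Real.rpow_mul hs.le, ← Real.rpow_natCast s 3]
    norm_num
  have e2 : ((s ^ 2) ^ (1 / 4 : ℝ)) ^ 2 = s := by
    rw [← Real.rpow_natCast s 2, ← Real.rpow_mul hs.le, ← Real.rpow_natCast, ← Real.rpow_mul hs.le]
    norm_num
  rw [e1] at h2
  have hd : (0 : ℝ) < d := lt_of_lt_of_le (by positivity) h2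
  have hΔ2 : Δ ^ 2 ≤ K ^ 2 / s := by
    have := pow_le_pow_left₀ h3 h4 2
    rwa [div_pow, e2] at this
  have hΔ1 : Δ ^ 2 ≤ 1 := hΔ2.trans ((div_le_one hs).2 hs')
  refine ⟨hC, hb, ?_, h1, ?_, (exp_sqrtLog_sq hn0).symm, by exact_mod_cast hd, h2, h3, ?_, hΔ2, h5,
    le_trans (mul_nonneg (by linarith) (by positivity)) h5, h6⟩
  · rw [le_div_iff₀ hγ]
    push_cast at h1
    have : (C : ℝ) * (b * γ) ≤ C * 1 := by linarith
    exact le_of_mul_le_mul_left this hC'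
  · push_cast; nlinarith
  · exact (sq_le_one_iff₀ h3).1 hΔ1

theorem eventually_regimeBounds {γ κ : ℝ} (K L : ℝ) (hγ : 0 < γ) (hκ : 0 < κ) :
    ∀ᶠ n : ℕ in atTop, ∀ (C b d : ℕ) (Δ β : ℝ), C * b = n → ClusterRegime γ κ K L C b d Δ β →
      RegimeBounds γ κ K L C b d Δ β (sqrtLog n) := by
  filter_upwards [eventually_gt_atTop 0, tendsto_sqrtLog.eventually_gt_atTop 0,
    tendsto_sqrtLog.eventually_ge_atTop (K ^ 2)] with n h1 h2 h3 C b d Δ β hn h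
  exact h.bounds hγ hκ hn h1 h2 h3

/-- The exponent `3 / 2` in the dimension bound enters here: it makes `exp (O(β² / d))` equal to
`n^{o(1)}`. -/
theorem RegimeBounds.temp_sq_div_le {γ κ K L : ℝ} (hκ : 0 < κ) {C b d : ℕ} {Δ β s : ℝ}
    (h : RegimeBounds γ κ K L C b d Δ β s) (hs : 0 < s) : β ^ 2 / d ≤ L ^ 2 / κ * s := by
  have hβ := pow_le_pow_left₀ h.temp_nonneg h.temp_le 2
  calc β ^ 2 / d ≤ (L * s ^ 2) ^ 2 / (κ * s ^ 3) := by
        gcongr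
        exact h.dim
    _ = L ^ 2 / κ * s := by field_simp

theorem RegimeBounds.temp_div_le {γ κ K L : ℝ} (hκ : 0 < κ) {C b d : ℕ} {Δ β s : ℝ}
    (h : RegimeBounds γ κ K L C b d Δ β s) (hs : 0 < s) : β / d ≤ L / κ / s := by
  have hL : 0 ≤ L * s ^ 2 := h.temp_nonneg.trans h.temp_le
  calc β / d ≤ L * s ^ 2 / (κ * s ^ 3) := by
        gcongr
        · exact h.temp_le
        · exact h.dim
    _ = L / κ / s := by field_simp

/-! ### Upper bound -/

theorem eventually_butterfly {γ κ K L ε : ℝ} (hγ : 0 < γ) (hκ : 0 < κ) (hL : 0 < L) (hε : 0 < ε) :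
    ∃ η g : ℕ → ℝ, Tendsto η atTop (𝓝 0) ∧ Tendsto g atTop (𝓝 0) ∧ ∀ᶠ n : ℕ in atTop,
      ∀ (C b d : ℕ) (Δ β : ℝ), C * b = n → (ClusterRegime γ κ K L C b d Δ β ∧ Even C) →
        clusterMeasure C b d Δ {ω | ¬ ∃ (m r : ℕ)
            (R : Matrix (Fin C × Fin b) (Fin C × Fin b) ℝ),
              IsFlatBlockButterflyAddLowRank C b m r R ∧
              (flatBlockButterflyLowRankParams C b m r : ℝ)
                ≤ ((C * b : ℕ) : ℝ) ^ (1 + η (C * b)) ∧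
              ‖attentionMatrix β ω - R‖ ≤ ε * ((C * b : ℕ) : ℝ)} ≤ ENNReal.ofReal (g n) := by
  let e := Real.exp 1
  have he1 : 1 ≤ e := Real.one_le_exp zero_le_one
  -- With `N ≥ A s`, the Taylor gain `exp (-2N)` beats the moment `exp (64 (e β)² / d) ≤ exp ((2A -
  -- 2) s)`.
  let A : ℝ := 32 * e ^ 2 * L ^ 2 / κ + 1
  have hA : 0 < A := by positivity
  -- `exp (F s)` bounds the number of parameters divided by `n`. As `n = exp (s²)`, it equals `n ^
  -- (F s / s²)`.
  let F : ℝ → ℝ := fun s => (1 + 2 / γ) + 2 * (A * s + 1) + 6 * (A * s + 1) * Real.log s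
  have hF : Tendsto (fun s => F s / s ^ 2) atTop (𝓝 0) := by
    have h1 : Tendsto (fun s : ℝ => s⁻¹) atTop (𝓝 0) := tendsto_inv_atTop_zero
    have h2 : Tendsto (fun s : ℝ => Real.log s / s) atTop (𝓝 0) :=
      Real.isLittleO_log_id_atTop.tendsto_div_nhds_zero
    have h3 : Tendsto (fun s : ℝ => (1 + 2 / γ) * (s⁻¹ * s⁻¹) + 2 * (A * s⁻¹ + s⁻¹ * s⁻¹)
        + 6 * (A + s⁻¹) * (Real.log s / s)) atTop
        (𝓝 ((1 + 2 / γ) * (0 * 0) + 2 * (A * 0 + 0 * 0) + 6 * (A + 0) * 0)) :=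
      (((h1.mul h1).const_mul _).add (((h1.const_mul A).add (h1.mul h1)).const_mul 2)).add
        (((h1.const_add A).const_mul 6).mul h2)
    simp only [mul_zero, add_zero] at h3
    refine h3.congr' ?_
    filter_upwards [eventually_gt_atTop 0] with s hs
    simp only [F]
    field_simp
  let g : ℝ → ℝ := fun s =>
    (2 * Real.exp (-s) + 2 * Real.exp (64 * L ^ 2) * (s⁻¹ * s⁻¹)) / ε ^ 2
  have hg : Tendsto g atTop (𝓝 0) := by
    have h1 : Tendsto (fun s : ℝ => s⁻¹) atTop (𝓝 0) := tendsto_inv_atTop_zero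
    have h3 := (((Real.tendsto_exp_neg_atTop_nhds_zero.const_mul 2).add
      ((h1.mul h1).const_mul (2 * Real.exp (64 * L ^ 2)))).div_const (ε ^ 2))
    simpa using h3
  refine ⟨fun n => F (sqrtLog n) / sqrtLog n ^ 2, fun n => g (sqrtLog n), hF.comp tendsto_sqrtLog,
    hg.comp tendsto_sqrtLog, ?_⟩
  filter_upwards [eventually_regimeBounds K L hγ hκ, tendsto_sqrtLog.eventually_ge_atTop 1,
    tendsto_sqrtLog.eventually_ge_atTop (16 * e * (L / κ)),
    tendsto_sqrtLog.eventually_ge_atTop (16 * L)] with n hreg hs1 hs2 hs3 C b d Δ β hn ⟨hR, hC⟩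
  have h := hreg C b d Δ β hn hR
  subst hn
  set s := sqrtLog (C * b) with hs_def
  have hs0 : 0 < s := by linarith
  have hlog0 : 0 ≤ Real.log s := Real.log_nonneg hs1
  have hn0 : 0 < C * b := Nat.mul_pos h.C_pos h.b_pos
  have hn1 : (1 : ℝ) ≤ ((C * b : ℕ) : ℝ) := by exact_mod_cast hn0
  have hd0 : (0 : ℝ) < d := by exact_mod_cast h.d_pos
  have hparams : ∀ r : ℕ, (r : ℝ) ≤ (A * s + 1) * Real.exp (6 * (A * s + 1) * Real.log s) →
      (flatBlockButterflyLowRankParams C b 1 r : ℝ)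
        ≤ ((C * b : ℕ) : ℝ) ^ (1 + F s / s ^ 2) := by
    intro r hr
    have e1 : ((C * b : ℕ) : ℝ) ^ (1 + F s / s ^ 2) = ((C * b : ℕ) : ℝ) * Real.exp (F s) := by
      rw [h.n_eq, ← Real.exp_mul, ← Real.exp_add]
      congr 1; field_simp
    have e2 : (flatBlockButterflyLowRankParams C b 1 r : ℝ)
        = 1 + 2 * (((C * b : ℕ) : ℝ) * b) + 2 * (((C * b : ℕ) : ℝ) * r) := by
      unfold flatBlockButterflyLowRankParams; push_cast; ring
    rw [e1, e2]
    set X := 6 * (A * s + 1) * Real.log s with hX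
    have hX0 : 0 ≤ X := by positivity
    have hb2 : 2 * (b : ℝ) ≤ 2 / γ := by
      have := h.b_le
      rw [show 2 / γ = 2 * (1 / γ) by ring]; linarith
    have h3 : (1 + 2 / γ) + 2 * r ≤ Real.exp (F s) := by
      have h4 : Real.exp (F s)
          = Real.exp ((1 + 2 / γ) + 2 * (A * s + 1)) * Real.exp X := by
        rw [← Real.exp_add]
      have h5 := Real.add_one_le_exp ((1 + 2 / γ) + 2 * (A * s + 1))
      have h6 : 1 ≤ Real.exp X := Real.one_le_exp hX0
      have h7 : 0 ≤ 1 + 2 / γ := by positivity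
      have h8 : 0 ≤ A * s + 1 := by positivity
      rw [h4]
      calc (1 + 2 / γ) + 2 * r ≤ (1 + 2 / γ) * Real.exp X + 2 * ((A * s + 1) * Real.exp X) := by
            gcongr
            exact le_mul_of_one_le_right h7 h6
        _ = ((1 + 2 / γ) + 2 * (A * s + 1)) * Real.exp X := by ring
        _ ≤ _ := by gcongr; linarith
    calc 1 + 2 * (((C * b : ℕ) : ℝ) * b) + 2 * (((C * b : ℕ) : ℝ) * r)
        ≤ ((C * b : ℕ) : ℝ) * ((1 + 2 / γ) + 2 * r) := by nlinarith
      _ ≤ _ := by gcongr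
  suffices hN : ∃ (N : ℕ) (a : ℝ), 1 ≤ a ∧ (8 * (a * β) / d) ^ 2 ≤ 1 / 2 ∧
      ((∑ l : Fin N, d ^ (l : ℕ) : ℕ) : ℝ)
        ≤ (A * s + 1) * Real.exp (6 * (A * s + 1) * Real.log s) ∧
      2 * (a ^ (2 * N))⁻¹ * Real.exp (64 * (a * β) ^ 2 / d) / ε ^ 2 ≤ g s by
    obtain ⟨N, a, ha, hβ, hr, hgs⟩ := hN
    refine (measure_mono fun ω hω => ?_).trans ((measure_not_exists_butterfly_le N h.d_pos
      h.dist_nonneg h.dist_le_one ha hβ hε hC hn0).trans (ENNReal.ofReal_le_ofReal hgs))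
    rintro ⟨R, hR1, hR2⟩
    exact hω ⟨1, _, R, hR1, hparams _ hr, hR2⟩
  -- In small dimension the rank is at most `s ^ O(s) = n^{o(1)}`. In large dimension the rank one
  -- matrix of ones is used, with `a = s`; the power `6` keeps `(s β)² / d` bounded, and the error
  -- decays as `s⁻²`.
  rcases le_or_gt (d : ℝ) (s ^ 6) with hd | hd
  · set N := ⌈A * s⌉₊ with hN
    have hN1 : A * s ≤ N := Nat.le_ceil _
    have hN2 : (N : ℝ) ≤ A * s + 1 := (Nat.ceil_lt_add_one (by positivity)).le
    refine ⟨N, e, he1, ?_, ?_, ?_⟩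
    · have h1 : 8 * (e * β) / d ≤ 1 / 2 := by
        calc 8 * (e * β) / d = 8 * e * (β / d) := by ring
          _ ≤ 8 * e * (L / κ / s) :=
            mul_le_mul_of_nonneg_left (h.temp_div_le hκ hs0) (by positivity)
          _ = (8 * e * (L / κ)) / s := by ring
          _ ≤ 1 / 2 := by
            rw [div_le_iff₀ hs0]; linarith
      have h0 : 0 ≤ 8 * (e * β) / d := by have := h.temp_nonneg; positivity
      nlinarith
    · have h1 : (1 : ℝ) ≤ d := by exact_mod_cast h.d_pos
      push_cast
      calc ∑ l : Fin N, (d : ℝ) ^ (l : ℕ) ≤ ∑ _l : Fin N, (d : ℝ) ^ N := by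
            gcongr with l
            exact l.2.le
        _ = N * (d : ℝ) ^ N := by simp
        _ ≤ (A * s + 1) * (s ^ 6) ^ N := by gcongr
        _ ≤ _ := by
            gcongr
            rw [← pow_mul, ← Real.exp_log (pow_pos hs0 (6 * N)), Real.log_pow]
            apply Real.exp_le_exp.2
            push_cast
            gcongr
    · simp only [g]
      gcongr
      have h1 : 2 * (e ^ (2 * N))⁻¹ * Real.exp (64 * (e * β) ^ 2 / d) ≤ 2 * Real.exp (-s) := by
        have h2 : (e ^ (2 * N))⁻¹ = Real.exp (-(2 * N)) := by
          rw [← Real.exp_nat_mul, ← Real.exp_neg]; push_cast; ring_nf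
        rw [h2, mul_assoc, ← Real.exp_add]
        gcongr
        have h3 : 64 * (e * β) ^ 2 / d ≤ (2 * A - 2) * s := by
          calc 64 * (e * β) ^ 2 / d = 64 * e ^ 2 * (β ^ 2 / d) := by ring
            _ ≤ 64 * e ^ 2 * (L ^ 2 / κ * s) := by
              gcongr
              exact h.temp_sq_div_le hκ hs0
            _ = (2 * A - 2) * s := by simp only [A]; ring
        linarith
      have h2 : 0 ≤ 2 * Real.exp (64 * L ^ 2) * (s⁻¹ * s⁻¹) := by positivity
      linarith
  · have hs6 : 0 < s ^ 6 := by positivity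
    refine ⟨1, s, hs1, ?_, ?_, ?_⟩
    · have h1 : 8 * (s * β) / d ≤ 1 / 2 := by
        calc 8 * (s * β) / d ≤ 8 * (s * (L * s ^ 2)) / s ^ 6 := by
              gcongr
              exact h.temp_le
          _ = 8 * L / s ^ 3 := by field_simp
          _ ≤ 1 / 2 := by
              rw [div_le_iff₀ (by positivity)]
              nlinarith [pow_le_pow_right₀ hs1 (show 1 ≤ 3 by norm_num)]
      have h0 : 0 ≤ 8 * (s * β) / d := by have := h.temp_nonneg; positivity
      nlinarith
    · simp only [Fin.sum_univ_one, Fin.val_zero, pow_zero, Nat.cast_one]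
      have h1 : 1 ≤ Real.exp (6 * (A * s + 1) * Real.log s) := Real.one_le_exp (by positivity)
      have h2 : 1 ≤ A * s + 1 := by have := mul_pos hA hs0; linarith
      nlinarith
    · simp only [g]
      gcongr
      have h1 : 64 * (s * β) ^ 2 / d ≤ 64 * L ^ 2 := by
        have hβ := pow_le_pow_left₀ h.temp_nonneg h.temp_le 2
        calc 64 * (s * β) ^ 2 / d ≤ 64 * (s * (L * s ^ 2)) ^ 2 / s ^ 6 := by
              have := h.temp_nonneg
              gcongr
              exact h.temp_le
          _ = 64 * L ^ 2 := by field_simp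
      have h2 : 2 * (s ^ (2 * 1))⁻¹ * Real.exp (64 * (s * β) ^ 2 / d)
          ≤ 2 * Real.exp (64 * L ^ 2) * (s⁻¹ * s⁻¹) := by
        rw [show (s ^ (2 * 1))⁻¹ = s⁻¹ * s⁻¹ by rw [mul_one, sq, mul_inv]]
        calc 2 * (s⁻¹ * s⁻¹) * Real.exp (64 * (s * β) ^ 2 / d)
            ≤ 2 * (s⁻¹ * s⁻¹) * Real.exp (64 * L ^ 2) := by gcongr
          _ = _ := by ring
      have h3 := Real.exp_pos (-s)
      linarith

/-! ### Lower bound for sparse approximations -/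

theorem eventually_sparse {γ κ K L : ℝ} (hγ : 0 < γ) (hκ : 0 < κ) {s : ℕ → ℝ}
    (hs : s =o[atTop] fun n : ℕ => (n : ℝ) ^ 2) :
    ∀ᶠ n : ℕ in atTop, ∀ (C b d : ℕ) (Δ β : ℝ), C * b = n → ClusterRegime γ κ K L C b d Δ β →
      clusterMeasure C b d Δ {ω | ¬ ∀ R : Matrix (Fin C × Fin b) (Fin C × Fin b) ℝ,
        (numNonzeros R : ℝ) ≤ s (C * b) →
          γ / 8 * ((C * b : ℕ) : ℝ) ≤ ‖attentionMatrix β ω - R‖}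
        ≤ ENNReal.ofReal (16 / γ ^ 2 * ((n : ℝ)⁻¹ * (n : ℝ)⁻¹)) := by
  -- Half of the `γ² n² / 16` coming from `C² / 16`; the remaining half exceeds `(γ / 8)² n²`.
  have hs' := hs.def (c := γ ^ 2 / 32) (by positivity)
  have hlarge := tendsto_natCast_atTop_atTop (R := ℝ) |>.eventually_ge_atTop (2 / γ)
  filter_upwards [eventually_regimeBounds K L hγ hκ, hs', hlarge,
    eventually_gt_atTop 0] with n hreg hsn hn2 hn0 C b d Δ β hn hR
  have h := hreg C b d Δ β hn hR
  subst hn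
  have hn0' : (0 : ℝ) < ((C * b : ℕ) : ℝ) := by exact_mod_cast hn0
  set ν : ℝ := ((C * b : ℕ) : ℝ) with hν
  have hC2 : (2 : ℝ) ≤ C := by
    refine le_trans ?_ h.le_C
    rwa [div_le_iff₀' hγ] at hn2
  have hCsq : γ ^ 2 * ν ^ 2 ≤ (C : ℝ) ^ 2 := by
    rw [← mul_pow]; exact pow_le_pow_left₀ (by positivity) h.le_C 2
  have hs2 : s (C * b) ≤ γ ^ 2 / 32 * ν ^ 2 := by
    rw [Real.norm_of_nonneg (sq_nonneg ν)] at hsn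
    exact (le_abs_self _).trans hsn
  refine (measure_mono fun ω hω => ?_).trans ((measure_not_sparse_le (s := s (C * b))
    h.temp_nonneg (by exact_mod_cast hC2) h.b_pos).trans (ENNReal.ofReal_le_ofReal ?_))
  · intro hall
    refine hω fun R hR => le_of_sq_le_sq ?_ (norm_nonneg _)
    refine le_trans ?_ (hall R hR)
    rw [mul_pow, div_pow]
    nlinarith [mul_pos (pow_pos hγ 2) (pow_pos hn0' 2)]
  · rw [← mul_inv, ← sq, ← div_eq_mul_inv, div_div]
    gcongr

/-! ### Lower bounds for low-rank approximations in the parameter regime -/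

/-- The failure probability of the low-rank lower bounds, as a function of `s = √(log n)`. -/
noncomputable def lowRankRate (γ κ L c ε q s : ℝ) : ℝ :=
  2 / (γ * c) * (q * Real.exp (-(κ * s ^ 3 * ε ^ 2 / 4))) + Real.exp (-(64 * (L ^ 2 / κ) * s + s))

theorem tendsto_lowRankRate {γ κ L c ε q : ℝ} (hκ : 0 < κ) (hε : 0 < ε) :
    Tendsto (fun n => lowRankRate γ κ L c ε q (sqrtLog n)) atTop (𝓝 0) := by
  have h1 : Tendsto (fun s : ℝ => κ * s ^ 3 * ε ^ 2 / 4) atTop atTop :=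
    (((tendsto_pow_atTop (by norm_num)).const_mul_atTop hκ).atTop_mul_const
      (by positivity)).atTop_div_const (by norm_num)
  have h2 : Tendsto (fun s : ℝ => 64 * (L ^ 2 / κ) * s + s) atTop atTop := by
    refine tendsto_atTop_mono' _ ?_ tendsto_id
    filter_upwards [eventually_ge_atTop 0] with s hs
    have : 0 ≤ 64 * (L ^ 2 / κ) * s := by positivity
    simpa using this
  have h3 := (((Real.tendsto_exp_neg_atTop_nhds_zero.comp h1).const_mul q).const_mul
    (2 / (γ * c))).add (Real.tendsto_exp_neg_atTop_nhds_zero.comp h2)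
  simp only [mul_zero, add_zero] at h3
  exact h3.comp tendsto_sqrtLog

/-- The surplus `n^δ = exp (δ s²)` of the singular values absorbs the off-block norm, of relative
size `exp (D s)`, and leaves a distance of at least `n`. -/
theorem eventually_one_add_exp_mul_le {D a δ : ℝ} (ha : 0 < a) (hδ : 0 < δ) :
    ∀ᶠ s : ℝ in atTop, 1 + Real.exp (D * s) ≤ a * Real.exp (δ * s ^ 2) := by
  have h1 : Tendsto (fun s : ℝ => Real.exp (-(s * (δ * s))) + Real.exp (-(s * (δ * s - D))))
      atTop (𝓝 (0 + 0)) := by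
    have e1 : Tendsto (fun s : ℝ => δ * s) atTop atTop := tendsto_id.const_mul_atTop hδ
    have e2 : Tendsto (fun s : ℝ => δ * s - D) atTop atTop := by
      simpa [sub_eq_add_neg] using tendsto_atTop_add_const_right _ (-D) e1
    exact (Real.tendsto_exp_neg_atTop_nhds_zero.comp (tendsto_id.atTop_mul_atTop₀ e1)).add
      (Real.tendsto_exp_neg_atTop_nhds_zero.comp (tendsto_id.atTop_mul_atTop₀ e2))
  rw [add_zero] at h1
  filter_upwards [h1.eventually_le_const ha] with s hs
  have h2 := mul_le_mul_of_nonneg_right hs (Real.exp_pos (δ * s ^ 2)).le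
  rw [add_mul, ← Real.exp_add, ← Real.exp_add] at h2
  rw [show -(s * (δ * s)) + δ * s ^ 2 = 0 by ring,
    show -(s * (δ * s - D)) + δ * s ^ 2 = D * s by ring, Real.exp_zero] at h2
  exact h2

open Classical in
-- The common part of both low-rank bounds. Up to `γ c n / 2` clusters are discarded; since `b ≤ 1 /
-- γ` this loses at most `c n / 2` rows, half of the rank deficit.
theorem eventually_low_rank {γ κ K L c δ ε q : ℝ} (hγ : 0 < γ) (hκ : 0 < κ) (hc : 0 < c)
    (hδ : 0 < δ) (hq : 0 ≤ q) :
    ∀ᶠ n : ℕ in atTop, ∀ (C b d : ℕ) (Δ β : ℝ), C * b = n →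
      RegimeBounds γ κ K L C b d Δ β (sqrtLog n) →
      ∀ (J : Type) [Fintype J] (g : J → Fin b), g.Injective →
      ∀ (A : Fin C → Set (ClusterSample C b d)) (σ : ℝ), (∀ i, MeasurableSet (A i)) →
      (∀ i, clusterMeasure C b d Δ (A i)
        ≤ ENNReal.ofReal (q * Real.exp (-(d * ε ^ 2 / 4)))) →
      Real.exp (sqrtLog n ^ 2 * (1 / 2 + δ)) ≤ σ →
      (∀ ω i, ω ∉ A i → ∀ v : J → ℝ, σ ^ 2 * ∑ j, v j ^ 2
        ≤ ∑ j, (∑ j', attentionMatrix β ω (i, g j) (i, g j') * v j') ^ 2) →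
      clusterMeasure C b d Δ {ω | ¬ ∀ R : Matrix (Fin C × Fin b) (Fin C × Fin b) ℝ,
        c / 2 * ((C * b : ℕ) : ℝ) + R.rank
            ≤ ((C : ℝ) - γ * c / 2 * ((C * b : ℕ) : ℝ)) * Fintype.card J →
          ((C * b : ℕ) : ℝ) ≤ ‖attentionMatrix β ω - R‖}
        ≤ ENNReal.ofReal (lowRankRate γ κ L c ε q (sqrtLog n)) := by
  filter_upwards [tendsto_sqrtLog.eventually_gt_atTop 0,
    tendsto_sqrtLog.eventually_ge_atTop (16 * (L / κ)),
    tendsto_sqrtLog.eventually (eventually_one_add_exp_mul_le (D := 64 * (L ^ 2 / κ) + 1)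
      (a := √(c / 2)) (by positivity) hδ)]
    with n hs0 hs1 hs2 C b d Δ β hn h J _ g hg A σ hA hp hσ hblock
  subst hn
  set s := sqrtLog (C * b) with hs_def
  have hn0' : (0 : ℝ) < ((C * b : ℕ) : ℝ) := by rw [h.n_eq]; positivity
  have hd0 : (0 : ℝ) < d := by exact_mod_cast h.d_pos
  have hβ : (8 * β / d) ^ 2 ≤ 1 / 2 := by
    have h1 : 8 * β / d ≤ 1 / 2 := by
      calc 8 * β / d = 8 * (β / d) := by ring
        _ ≤ 8 * (L / κ / s) :=
          mul_le_mul_of_nonneg_left (h.temp_div_le hκ hs0) (by norm_num)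
        _ = (8 * (L / κ)) / s := by ring
        _ ≤ 1 / 2 := by
          rw [div_le_iff₀ hs0]; linarith
    have h0 : 0 ≤ 8 * β / d := by have := h.temp_nonneg; positivity
    nlinarith
  have hσ0 : 0 < σ := (Real.exp_pos _).trans_le hσ
  set n : ℝ := ((C * b : ℕ) : ℝ) with hn_def
  -- This threshold for the off-block norm exceeds its typical size by a factor tending to infinity,
  -- so it is rarely reached.
  have hE : 0 < n * Real.exp ((64 * (L ^ 2 / κ) + 1) * s) := by positivity
  have hm := measure_not_low_rank_le h.d_pos h.dist_nonneg h.dist_le_one hβ hE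
    (k := c / 2 * n) (k' := γ * c / 2 * n) (by positivity) (by positivity) hg A hA hp
    (by positivity) hblock
  refine (measure_mono fun ω hω => ?_).trans (hm.trans (ENNReal.ofReal_le_ofReal ?_))
  · intro hall
    refine hω fun R hR => le_trans ?_ (hall R hR)
    have e1 : √n = Real.exp (s ^ 2 / 2) := by
      rw [hn_def, h.n_eq, ← Real.exp_half]
    have e2 : n * Real.exp (δ * s ^ 2) = Real.exp (s ^ 2 * (1 / 2 + δ)) * Real.exp (s ^ 2 / 2) := by
      rw [hn_def, h.n_eq, ← Real.exp_add, ← Real.exp_add]; congr 1; ring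
    have h1 : n * (√(c / 2) * Real.exp (δ * s ^ 2)) ≤ σ * √(c / 2 * n) := by
      rw [Real.sqrt_mul (by positivity), e1]
      calc n * (√(c / 2) * Real.exp (δ * s ^ 2)) = √(c / 2) * (n * Real.exp (δ * s ^ 2)) := by ring
        _ = Real.exp (s ^ 2 * (1 / 2 + δ)) * (√(c / 2) * Real.exp (s ^ 2 / 2)) := by
          rw [e2]; ring
        _ ≤ _ := by gcongr
    have h2 := mul_le_mul_of_nonneg_left hs2 hn0'.le
    linarith
  · unfold lowRankRate
    refine add_le_add ?_ ?_
    · calc (C : ℝ) * (q * Real.exp (-(d * ε ^ 2 / 4))) / (γ * c / 2 * n)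
          ≤ n * (q * Real.exp (-(κ * s ^ 3 * ε ^ 2 / 4))) / (γ * c / 2 * n) := by
            gcongr
            · exact h.C_le
            · exact h.dim
        _ = _ := by field_simp
    · have h1 : 64 * β ^ 2 / d ≤ 64 * (L ^ 2 / κ) * s := by
        have := h.temp_sq_div_le hκ hs0
        calc 64 * β ^ 2 / d = 64 * (β ^ 2 / d) := by ring
          _ ≤ 64 * (L ^ 2 / κ * s) := by gcongr
          _ = _ := by ring
      rw [mul_pow, mul_div_mul_left _ _ (by positivity), ← Real.exp_nat_mul, ← Real.exp_sub]
      apply Real.exp_le_exp.2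
      push_cast
      linarith

theorem eventually_low_rank_nondegenerate {γ κ K L c δ : ℝ} (hγ : 0 < γ) (hκ : 0 < κ)
    (hc : 0 < c) (hδ : 0 < δ) :
    ∃ g : ℕ → ℝ, Tendsto g atTop (𝓝 0) ∧ ∀ᶠ n : ℕ in atTop,
      ∀ (C b d : ℕ) (Δ β : ℝ), C * b = n → (ClusterRegime γ κ K L C b d Δ β ∧
          ((C * b : ℕ) : ℝ) ^ (-(1 / 4 : ℝ) + δ) ≤ Δ) →
        clusterMeasure C b d Δ {ω | ¬ ∀ R : Matrix (Fin C × Fin b) (Fin C × Fin b) ℝ,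
          c * ((C * b : ℕ) : ℝ) ≤ ((C * b : ℕ) : ℝ) - (R.rank : ℝ) →
            1 * ((C * b : ℕ) : ℝ) ≤ ‖attentionMatrix β ω - R‖} ≤ ENNReal.ofReal (g n) := by
  -- The third condition gives `(1 - Δ²)(1 - 3ε) ≥ 1 - δ` once `Δ² ≤ δ / 2`. The fourth gives `1 - ε
  -- - b ε ≥ 1 / 2`, so the Gram matrix of the deviations is at least `Δ² / 2`.
  obtain ⟨ε, hε0, hε1, hεδ, hεγ⟩ : ∃ ε : ℝ, 0 < ε ∧ ε ≤ 1 ∧ 3 * ε ≤ δ / 2 ∧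
      (1 + 1 / γ) * ε ≤ 1 / 2 := by
    refine ⟨min (min 1 (δ / 6)) (1 / 2 / (1 + 1 / γ)), by positivity,
      (min_le_left _ _).trans (min_le_left _ _), ?_, ?_⟩
    · have := (min_le_left (min 1 (δ / 6)) (1 / 2 / (1 + 1 / γ))).trans (min_le_right _ _)
      linarith
    · have := min_le_right (min 1 (δ / 6)) (1 / 2 / (1 + 1 / γ))
      rwa [le_div_iff₀' (by positivity)] at this
  -- Number of tail events per cluster, using `b ≤ 1 / γ`: one for the centre, `b` each for
  -- deviation norms and centre-deviation products, and two-sided ones for at most `b²` pairs of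
  -- deviations.
  set q : ℝ := 1 + 2 * (1 / γ) + 2 * (1 / γ) ^ 2 with hq
  have hq0 : 0 ≤ q := by positivity
  refine ⟨_, tendsto_lowRankRate (γ := γ) (L := L) (c := c) (q := q) hκ hε0, ?_⟩
  filter_upwards [eventually_regimeBounds K L hγ hκ, eventually_low_rank (K := K) (L := L)
    (ε := ε) (q := q) hγ hκ hc hδ hq0, tendsto_sqrtLog.eventually_ge_atTop 2,
    tendsto_sqrtLog.eventually_ge_atTop (2 * K ^ 2),
    tendsto_sqrtLog.eventually_ge_atTop (K ^ 2 / (δ / 2))]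
    with n hreg hlow hs2 hsK hsδ C b d Δ β hn ⟨hR, hΔn⟩
  have h := hreg C b d Δ β hn hR
  subst hn
  set s := sqrtLog (C * b) with hs_def
  have hs0 : 0 < s := by linarith
  have hΔhalf : Δ ^ 2 ≤ 1 / 2 := h.dist_sq_le.trans (by rw [div_le_iff₀ hs0]; linarith)
  have hΔδ : Δ ^ 2 ≤ δ / 2 := h.dist_sq_le.trans (by
    rw [div_le_iff₀ (by positivity)] at hsδ
    rw [div_le_iff₀ hs0]; linarith)
  have hΔexp : Real.exp (s ^ 2 * (-(1 / 4 : ℝ) + δ)) ≤ Δ := by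
    rwa [h.n_eq, ← Real.exp_mul] at hΔn
  have hΔ0 : 0 < Δ := (Real.exp_pos _).trans_le hΔexp
  have hbε : (b : ℝ) * ε ≤ 1 / γ * ε := mul_le_mul_of_nonneg_right h.b_le hε0.le
  have hn0' : (0 : ℝ) < ((C * b : ℕ) : ℝ) := by rw [h.n_eq]; positivity
  let p : ℝ := Real.exp (-(d * ε ^ 2 / 4))
  let A : Fin C → Set (ClusterSample C b d) := fun i =>
    {ω | ω.1 i ⬝ᵥ ω.1 i ≤ 1 - ε} ∪ ((⋃ j, {ω | ω.2 i j ⬝ᵥ ω.2 i j ≤ (1 - ε) * Δ ^ 2}) ∪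
      ((⋃ j, {ω | ω.1 i ⬝ᵥ ω.2 i j ≤ -ε}) ∪
        ⋃ x : {x : Fin b × Fin b // x.1 ≠ x.2},
          {ω | ε * Δ ^ 2 ≤ |ω.2 i x.1.1 ⬝ᵥ ω.2 i x.1.2|}))
  have hA : ∀ i, MeasurableSet (A i) := fun i =>
    (measurableSet_le (by fun_prop) (by fun_prop)).union <|
      (MeasurableSet.iUnion fun j => measurableSet_le (by fun_prop) (by fun_prop)).union <|
      (MeasurableSet.iUnion fun j => measurableSet_le (by fun_prop) (by fun_prop)).union <|
      MeasurableSet.iUnion fun x => measurableSet_le (by fun_prop) (by fun_prop)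
  have hsum : ∀ {ι : Type} [Fintype ι] (S : ι → Set (ClusterSample C b d)) {x y : ℝ}, 0 ≤ x →
      (∀ j, clusterMeasure C b d Δ (S j) ≤ ENNReal.ofReal x) → Fintype.card ι * x ≤ y →
      clusterMeasure C b d Δ (⋃ j, S j) ≤ ENNReal.ofReal y := by
    intro ι _ S x y _ hS hxy
    refine (measure_iUnion_fintype_le _ _).trans ((Finset.sum_le_sum fun j _ => hS j).trans ?_)
    rw [Finset.sum_const, nsmul_eq_mul, Finset.card_univ, ← ENNReal.ofReal_natCast,
      ← ENNReal.ofReal_mul (by positivity)]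
    exact ENNReal.ofReal_le_ofReal hxy
  have hp0 : 0 < p := Real.exp_pos _
  have hp : ∀ i, clusterMeasure C b d Δ (A i) ≤ ENNReal.ofReal (q * p) := by
    intro i
    have hb : (b : ℝ) * p ≤ 1 / γ * p := mul_le_mul_of_nonneg_right h.b_le hp0.le
    have hpairs : (Fintype.card {x : Fin b × Fin b // x.1 ≠ x.2} : ℝ) ≤ (1 / γ) ^ 2 := by
      have h1 : Fintype.card {x : Fin b × Fin b // x.1 ≠ x.2} ≤ b ^ 2 := by
        refine (Fintype.card_subtype_le _).trans (le_of_eq ?_)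
        simp [sq]
      calc (Fintype.card {x : Fin b × Fin b // x.1 ≠ x.2} : ℝ) ≤ (b : ℝ) ^ 2 := by exact_mod_cast h1
        _ ≤ _ := pow_le_pow_left₀ (Nat.cast_nonneg b) h.b_le 2
    have e : q * p = p + (1 / γ * p + (1 / γ * p + (1 / γ) ^ 2 * (2 * p))) := by
      rw [hq]; ring
    rw [e, ENNReal.ofReal_add (by positivity) (by positivity),
      ENNReal.ofReal_add (by positivity) (by positivity),
      ENNReal.ofReal_add (by positivity) (by positivity)]
    refine (measure_union_le _ _).trans (add_le_add (measure_centre_normSq_le h.d_pos hε0.le i) ?_)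
    refine (measure_union_le _ _).trans (add_le_add (hsum _ hp0.le
      (fun j => measure_deviation_normSq_le h.d_pos hΔ0 hε0.le i j) (by simpa using hb)) ?_)
    refine (measure_union_le _ _).trans (add_le_add (hsum _ hp0.le
      (fun j => measure_centre_deviation_le h.d_pos h.dist_nonneg h.dist_le_one hε0 hε1 i j)
        (by simpa using hb)) ?_)
    exact hsum _ (by positivity)
      (fun x => measure_abs_deviation_deviation_ge h.d_pos hΔ0 hε0 hε1 i x.2)
        (mul_le_mul_of_nonneg_right hpairs (by positivity))
  have hgap : Δ ^ 2 / 2 ≤ (1 - ε) * Δ ^ 2 - Fintype.card (Fin b) * (ε * Δ ^ 2) := by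
    rw [Fintype.card_fin]
    have h1 : 1 / 2 ≤ 1 - ε - b * ε := by linarith
    have h2 := mul_le_mul_of_nonneg_right h1 (sq_nonneg Δ)
    linarith
  have hβ2 : 2 ≤ β := by
    have h1 : 1 / 2 * s ^ 2 ≤ (1 - Δ ^ 2) * s ^ 2 := by gcongr; linarith
    have h2 := h.temp_ge
    nlinarith
  set σ := Real.exp (β * (1 - ε - 2 * ε)) *
    (β * ((1 - ε) * Δ ^ 2 - Fintype.card (Fin b) * (ε * Δ ^ 2))) with hσ
  -- The centre gives `n^{1-δ}` and the Gram matrix at least `Δ² ≥ n^{-1/2+2δ}`; this is where the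
  -- exponent `-1/4 + δ` is needed.
  have hσ1 : Real.exp (s ^ 2 * (1 / 2 + δ)) ≤ σ := by
    have h1 : s ^ 2 * (1 - δ) ≤ β * (1 - ε - 2 * ε) := by
      have h2 : 0 ≤ 1 - ε - 2 * ε := by
        have h3 : 1 / γ * ε ≥ 0 := by positivity
        have hb1 : (1 : ℝ) ≤ 1 / γ := le_trans (by exact_mod_cast h.b_pos) h.b_le
        have h4 : 1 * ε ≤ 1 / γ * ε := mul_le_mul_of_nonneg_right hb1 hε0.le
        nlinarith
      calc s ^ 2 * (1 - δ) ≤ s ^ 2 * ((1 - Δ ^ 2) * (1 - ε - 2 * ε)) := by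
            gcongr
            have h3 : 0 ≤ Δ ^ 2 * (3 * ε) := by positivity
            nlinarith
        _ = (1 - Δ ^ 2) * s ^ 2 * (1 - ε - 2 * ε) := by ring
        _ ≤ _ := by
            gcongr
            exact h.temp_ge
    have h2 : Real.exp (s ^ 2 * (-(1 / 2) + 2 * δ)) ≤ Δ ^ 2 := by
      have := pow_le_pow_left₀ (Real.exp_pos _).le hΔexp 2
      rwa [← Real.exp_nat_mul, Nat.cast_ofNat, show 2 * (s ^ 2 * (-(1 / 4 : ℝ) + δ))
        = s ^ 2 * (-(1 / 2) + 2 * δ) by ring] at this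
    have h3 : Δ ^ 2 ≤ β * ((1 - ε) * Δ ^ 2 - Fintype.card (Fin b) * (ε * Δ ^ 2)) := by
      calc Δ ^ 2 = 2 * (Δ ^ 2 / 2) := by ring
        _ ≤ _ := by gcongr
    calc Real.exp (s ^ 2 * (1 / 2 + δ))
        = Real.exp (s ^ 2 * (1 - δ)) * Real.exp (s ^ 2 * (-(1 / 2) + 2 * δ)) := by
          rw [← Real.exp_add]; congr 1; ring
      _ ≤ σ := mul_le_mul (Real.exp_le_exp.2 h1) (h2.trans h3) (Real.exp_pos _).le
          (Real.exp_pos _).le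
  have hmain := hlow C b d Δ β rfl h (Fin b) id Function.injective_id A σ hA hp hσ1
    fun ω i hω v => by
      simp only [A, Set.mem_union, Set.mem_iUnion, not_or, not_exists] at hω
      obtain ⟨h1, h2, h3, h4⟩ := hω
      exact cluster_block_ge (ω.1 i) (ω.2 i) h.temp_nonneg (fun j => (not_le.1 (h2 j)).le)
        (by positivity) (fun j j' hj => (not_le.1 (h4 ⟨(j, j'), hj⟩)).le)
        (le_trans (by positivity) hgap) (not_le.1 h1).le (fun j => (not_le.1 (h3 j)).le) v
  refine (measure_mono fun ω hω => ?_).trans hmain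
  intro hall
  refine hω fun R hR => ?_
  rw [one_mul]
  refine hall R ?_
  rw [Fintype.card_fin]
  have h1 : γ * (b : ℝ) ≤ 1 := by
    have := h.b_le
    rwa [le_div_iff₀' hγ] at this
  have h2 : γ * c / 2 * ((C * b : ℕ) : ℝ) * b ≤ c / 2 * ((C * b : ℕ) : ℝ) := by
    calc γ * c / 2 * ((C * b : ℕ) : ℝ) * b = γ * b * (c / 2 * ((C * b : ℕ) : ℝ)) := by ring
      _ ≤ 1 * (c / 2 * ((C * b : ℕ) : ℝ)) := by gcongr
      _ = _ := one_mul _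
  have h3 : (C : ℝ) * b = ((C * b : ℕ) : ℝ) := by push_cast; ring
  rw [sub_mul, h3]
  linarith

/-- With one input per cluster the blocks are single diagonal entries, which are large whatever the
deviations' size; hence `C` replaces `n` in the rank condition. -/
theorem eventually_low_rank_clusters {γ κ K L c : ℝ} (hγ : 0 < γ) (hκ : 0 < κ) (hc : 0 < c) :
    ∃ g : ℕ → ℝ, Tendsto g atTop (𝓝 0) ∧ ∀ᶠ n : ℕ in atTop,
      ∀ (C b d : ℕ) (Δ β : ℝ), C * b = n → ClusterRegime γ κ K L C b d Δ β →
        clusterMeasure C b d Δ {ω | ¬ ∀ R : Matrix (Fin C × Fin b) (Fin C × Fin b) ℝ,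
          c * ((C * b : ℕ) : ℝ) ≤ (C : ℝ) - (R.rank : ℝ) →
            1 * ((C * b : ℕ) : ℝ) ≤ ‖attentionMatrix β ω - R‖} ≤ ENNReal.ofReal (g n) := by
  -- Chosen so that `‖c + r‖² ≥ 1 - 3 / 24 = 7 / 8`. With `β ≥ 7/8 log n` the entry is at least
  -- `n^{49/64}`, above the required `n^{1/2+1/8}`.
  have hε0 : (0 : ℝ) < 1 / 24 := by norm_num
  refine ⟨_, tendsto_lowRankRate (γ := γ) (L := L) (c := c) (q := 2) hκ hε0, ?_⟩
  filter_upwards [eventually_regimeBounds K L hγ hκ, eventually_low_rank (K := K) (L := L)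
    (ε := 1 / 24) (q := 2) (δ := 1 / 8) hγ hκ hc (by norm_num) (by norm_num),
    tendsto_sqrtLog.eventually_gt_atTop 0, tendsto_sqrtLog.eventually_ge_atTop (8 * K ^ 2)]
    with n hreg hlow hs0 hsK C b d Δ β hn hR
  have h := hreg C b d Δ β hn hR
  subst hn
  set s := sqrtLog (C * b) with hs_def
  have hΔ8 : Δ ^ 2 ≤ 1 / 8 := h.dist_sq_le.trans (by rw [div_le_iff₀ hs0]; linarith)
  let o : Fin b := ⟨0, h.b_pos⟩
  let A : Fin C → Set (ClusterSample C b d) := fun i =>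
    {ω | ω.1 i ⬝ᵥ ω.1 i ≤ 1 - 1 / 24} ∪ {ω | ω.1 i ⬝ᵥ ω.2 i o ≤ -(1 / 24)}
  have hp : ∀ i, clusterMeasure C b d Δ (A i)
      ≤ ENNReal.ofReal (2 * Real.exp (-(d * (1 / 24) ^ 2 / 4))) := by
    intro i
    rw [two_mul, ENNReal.ofReal_add (Real.exp_pos _).le (Real.exp_pos _).le]
    exact (measure_union_le _ _).trans (add_le_add
      (measure_centre_normSq_le h.d_pos hε0.le i) (measure_centre_deviation_le h.d_pos
        h.dist_nonneg h.dist_le_one hε0 (by norm_num) i o))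
  have hβ : s ^ 2 * (1 / 2 + 1 / 8) ≤ β * (7 / 8) := by
    have h1 : 7 / 8 * s ^ 2 ≤ (1 - Δ ^ 2) * s ^ 2 := by gcongr; linarith
    have h2 := h.temp_ge
    nlinarith [sq_nonneg s]
  have hmain := hlow C b d Δ β rfl h Unit (fun _ => o) (fun _ _ _ => rfl) A
    (Real.exp (β * (7 / 8)))
    (fun i => (measurableSet_le (by fun_prop) (by fun_prop)).union
      (measurableSet_le (by fun_prop) (by fun_prop))) hp (Real.exp_le_exp.2 hβ)
    fun ω i hω v => by
      simp only [A, Set.mem_union, not_or] at hω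
      have h1 : (1 - 1 / 24 : ℝ) < ω.1 i ⬝ᵥ ω.1 i := not_le.1 hω.1
      have h2 : (-(1 / 24) : ℝ) < ω.1 i ⬝ᵥ ω.2 i o := not_le.1 hω.2
      have h3 : 0 ≤ ω.2 i o ⬝ᵥ ω.2 i o :=
        Finset.sum_nonneg fun _ _ => mul_self_nonneg _
      have h4 : 7 / 8 ≤ inputRow ω (i, o) ⬝ᵥ inputRow ω (i, o) := by
        simp only [inputRow, add_dotProduct, dotProduct_add]
        rw [dotProduct_comm (ω.2 i o) (ω.1 i)]
        linarith
      simp only [Finset.univ_unique, Finset.sum_singleton, attentionMatrix_apply, mul_pow]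
      gcongr
      exact h.temp_nonneg
  refine (measure_mono fun ω hω => ?_).trans hmain
  intro hall
  refine hω fun R hR' => ?_
  rw [one_mul]
  refine hall R ?_
  have hb1 : (1 : ℝ) ≤ 1 / γ := le_trans (by exact_mod_cast h.b_pos) h.b_le
  have hγ1 : γ ≤ 1 := by rwa [le_div_iff₀ hγ, one_mul] at hb1
  have h2 : γ * (c / 2 * ((C * b : ℕ) : ℝ)) ≤ 1 * (c / 2 * ((C * b : ℕ) : ℝ)) := by gcongr
  simp only [Fintype.card_unit, Nat.cast_one, mul_one]
  linarith

theorem mainTheorem5 (γ κ K L : ℝ) (hγ : 0 < γ) (hκ : 0 < κ) (hK : 0 < K) (hL : 0 < L) :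
    -- flat block butterfly + low-rank
    (∀ ε : ℝ, 0 < ε → ε < 1 →
      ∃ (η : ℕ → ℝ) (ρ : ℕ → ℝ≥0∞), Tendsto η atTop (𝓝 0) ∧ Tendsto ρ atTop (𝓝 0) ∧
        ∀ (C b d : ℕ) (Δ β : ℝ), ClusterRegime γ κ K L C b d Δ β → Even C →
          clusterMeasure C b d Δ {ω | ¬ ∃ (m r : ℕ)
            (R : Matrix (Fin C × Fin b) (Fin C × Fin b) ℝ),
              IsFlatBlockButterflyAddLowRank C b m r R ∧
              (flatBlockButterflyLowRankParams C b m r : ℝ)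
                ≤ ((C * b : ℕ) : ℝ) ^ (1 + η (C * b)) ∧
              ‖attentionMatrix β ω - R‖ ≤ ε * ((C * b : ℕ) : ℝ)} ≤ ρ (C * b)) ∧
    -- low-rank, with a nondegenerate intra-cluster distance
    (∀ c δ : ℝ, 0 < c → 0 < δ →
      ∃ (c' : ℝ) (ρ : ℕ → ℝ≥0∞), 0 < c' ∧ Tendsto ρ atTop (𝓝 0) ∧
        ∀ (C b d : ℕ) (Δ β : ℝ), ClusterRegime γ κ K L C b d Δ β →
          ((C * b : ℕ) : ℝ) ^ (-(1 / 4 : ℝ) + δ) ≤ Δ →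
          clusterMeasure C b d Δ {ω | ¬ ∀ R : Matrix (Fin C × Fin b) (Fin C × Fin b) ℝ,
              c * ((C * b : ℕ) : ℝ) ≤ ((C * b : ℕ) : ℝ) - (R.rank : ℝ) →
              c' * ((C * b : ℕ) : ℝ) ≤ ‖attentionMatrix β ω - R‖} ≤ ρ (C * b)) ∧
    -- low-rank, with an arbitrary intra-cluster distance
    (∀ c : ℝ, 0 < c →
      ∃ (c' : ℝ) (ρ : ℕ → ℝ≥0∞), 0 < c' ∧ Tendsto ρ atTop (𝓝 0) ∧
        ∀ (C b d : ℕ) (Δ β : ℝ), ClusterRegime γ κ K L C b d Δ β →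
          clusterMeasure C b d Δ {ω | ¬ ∀ R : Matrix (Fin C × Fin b) (Fin C × Fin b) ℝ,
              c * ((C * b : ℕ) : ℝ) ≤ (C : ℝ) - (R.rank : ℝ) →
              c' * ((C * b : ℕ) : ℝ) ≤ ‖attentionMatrix β ω - R‖} ≤ ρ (C * b)) ∧
    -- sparse
    (∀ s : ℕ → ℝ, s =o[atTop] (fun n : ℕ => (n : ℝ) ^ 2) →
      ∃ (c' : ℝ) (ρ : ℕ → ℝ≥0∞), 0 < c' ∧ Tendsto ρ atTop (𝓝 0) ∧
        ∀ (C b d : ℕ) (Δ β : ℝ), ClusterRegime γ κ K L C b d Δ β →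
          clusterMeasure C b d Δ {ω | ¬ ∀ R : Matrix (Fin C × Fin b) (Fin C × Fin b) ℝ,
              (numNonzeros R : ℝ) ≤ s (C * b) →
              c' * ((C * b : ℕ) : ℝ) ≤ ‖attentionMatrix β ω - R‖} ≤ ρ (C * b)) := by
  refine ⟨fun ε hε _ => ?_, fun c δ hc hδ => ?_, fun c hc => ?_, fun s hs => ?_⟩
  · obtain ⟨η, g, hη, hg, h⟩ := eventually_butterfly (K := K) hγ hκ hL hε
    obtain ⟨ρ, hρ, hle⟩ := exists_uniform_rate hg h
    exact ⟨η, ρ, hη, hρ, fun C b d Δ β hR hC => hle C b d Δ β ⟨hR, hC⟩⟩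
  · obtain ⟨g, hg, h⟩ := eventually_low_rank_nondegenerate (K := K) (L := L) hγ hκ hc hδ
    obtain ⟨ρ, hρ, hle⟩ := exists_uniform_rate hg h
    -- `c' = 1` works for every `c`, because the singular value bound exceeds what is needed by the
    -- factor `n^δ`.
    exact ⟨1, ρ, one_pos, hρ, fun C b d Δ β hR hΔ => hle C b d Δ β ⟨hR, hΔ⟩⟩
  · obtain ⟨g, hg, h⟩ := eventually_low_rank_clusters (K := K) (L := L) hγ hκ hc
    obtain ⟨ρ, hρ, hle⟩ := exists_uniform_rate hg h
    exact ⟨1, ρ, one_pos, hρ, hle⟩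
  · have hg : Tendsto (fun n : ℕ => 16 / γ ^ 2 * ((n : ℝ)⁻¹ * (n : ℝ)⁻¹)) atTop (𝓝 0) := by
      have h1 := tendsto_inv_atTop_nhds_zero_nat (𝕜 := ℝ)
      simpa using (h1.mul h1).const_mul (16 / γ ^ 2)
    obtain ⟨ρ, hρ, hle⟩ := exists_uniform_rate hg
      (eventually_sparse (K := K) (L := L) hγ hκ hs)
    exact ⟨γ / 8, ρ, by positivity, hρ, hle⟩
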